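/- Let $\gamma_n$ be the standard Gaussian measure on $\mathbb{R}^n$, let $\|\cdot\|_q$ denote the norm of $L^q(\gamma_n)$, and for a smooth enough $f:\mathbb{R}^n\to\mathbb{R}$ let $\nabla^k f=(\partial_{i_1,\ldots,i_k}f)_{1\le i_1,\ldots,i_k\le n}$ be the tensor of its $k$-th order partial derivatives, with $|\cdot|$ the Euclidean norm on $\mathbb{R}^{n^k}$. Theorem. There is a universal numerical constant $C>0$ (independent of $n$, $p$ and $f$) such that the following holds. Let $p\ge 1$, and let $f\in C^{p+1}(\mathbb{R}^n)$ be such that $f$ and all its partial derivatives up to order $p+1$ belong to $L^2(\gamma_n)$. Then $$\mathrm{Var}_{\gamma_n}(f)\le \sum_{k=1}^p\frac{1}{k!}\left|\int_{\mathbb{R}^n}\nabla^k f\,d\gamma_n\right|^2+C\sum_{i_1,\ldots,i_{p+1}=1}^n\frac{\|\partial_{i_1,\ldots,i_{p+1}}f\|_2^2}{\left[1+\log\left(\frac{\|\partial_{i_1,\ldots,i_{p+1}}f\|_2}{\|\partial_{i_1,\ldots,i_{p+1}}f\|_1}\right)\right]^{p+1}},$$ where a term of the last sum is read as $0$ if $\partial_{i_1,\ldots,i_{p+1}}f$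 vanishes identically. -/

import Mathlib

open MeasureTheory ProbabilityTheory

/-- The partial derivative `∂_{i₀ … i_{k-1}} f` of order `k` of `f : ℝⁿ → ℝ`, that is, the `k`-th
differential of `f` applied to the canonical basis vectors `e_{i₀}, …, e_{i_{k-1}}`.
For `k = 0` it is `f`. -/
noncomputable def partialDeriv {n k : ℕ} (i : Fin k → Fin n) (f : EuclideanSpace ℝ (Fin n) → ℝ)
    (x : EuclideanSpace ℝ (Fin n)) : ℝ :=
  iteratedFDeriv ℝ k f x (fun j => EuclideanSpace.single (i j) (1 : ℝ))

/-- The tensor `∇ᵏ f (x)` of all partial derivatives of order `k` of `f` at `x`, an element of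
`ℝ^(nᵏ)` with its Euclidean norm (`k = 1`: the gradient, `k = 2`: the Hessian matrix). -/
noncomputable def nablaPow {n : ℕ} (k : ℕ) (f : EuclideanSpace ℝ (Fin n) → ℝ)
    (x : EuclideanSpace ℝ (Fin n)) : EuclideanSpace ℝ (Fin k → Fin n) :=
  WithLp.toLp 2 (fun i : Fin k → Fin n => partialDeriv i f x)

/-- The standard Gaussian measure `γ_n` on `ℝⁿ`. -/
noncomputable abbrev stdGaussMeasure (n : ℕ) : Measure (EuclideanSpace ℝ (Fin n)) :=
  stdGaussian (EuclideanSpace ℝ (Fin n))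

/-! Let `X`, `Y` be standard Gaussian vectors with correlation `r`, and let `G k r` be the sum of
`E[∂_i f(X) ∂_i f(Y)]` over multi-indices `i` of length `k`. Then `G 0 1 = E f²`, `G 0 0 = (E f)²`
and `G k 0 = |E ∇ᵏf|²`. Rotation invariance and Gaussian integration by parts show that `G k` has
derivative `G (k+1)` (`hasDerivAt_gaussCov`, extended to the Sobolev setting in
`integral_sum_gaussCorr_fderiv`). The theorem is therefore Taylor's formula for `G 0` between 0 and
1 (`eq_sum_add_integral_of_integral_eq_sub`), together with a bound on the remainder `∫ (1-r)^p/p! ·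
G (p+1) r dr`.

The remainder is treated one partial derivative `g` at a time. Hypercontractivity
(`lintegral_correlated_le`) gives `E[g(X) g(Y)] ≤ ‖g‖²_{1+r}`. Interpolating `L^{1+r}` between `L¹`
and `L²` turns this into `‖g‖₂² exp(-(1-r) l)` with `l = log(‖g‖₂/‖g‖₁)`. Integrating against
`(1-r)^p/p!` produces `(1+l)^{-(p+1)}`, with constant `C = e`.

Hypercontractivity itself is obtained from a two-point inequality for correlated signs: it
tensorizes, and the central limit theorem carries it to Gaussian pairs. -/

section

open scoped ENNReal NNReal Topology
open Filter

local notation "𝔼" n => EuclideanSpace ℝ (Fin n)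

/-! ### The two-point inequality for correlated signs. -/

section TwoPoint

/-- The difference vanishes at 0 and its derivative is nonnegative by AM-GM: `(1+x)^(r-1)` and
`(1-x)^(r-1)` have product `(1-x²)^(r-1) ≥ 1`, hence sum at least 2. -/
lemma two_mul_mul_le_rpow_sub_rpow {r y : ℝ} (hr0 : 0 < r) (hr1 : r < 1) (hy0 : 0 ≤ y)
    (hy1 : y ≤ 1) : 2 * r * y ≤ (1 + y) ^ r - (1 - y) ^ r := by
  have hd : ∀ x ∈ Set.Ioo (0 : ℝ) 1, HasDerivAt
      (fun y : ℝ => (1 + y) ^ r - (1 - y) ^ r - 2 * r * y)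
      (1 * r * (1 + x) ^ (r - 1) - (-1) * r * (1 - x) ^ (r - 1) - 2 * r * 1) x := fun x hx =>
    ((((hasDerivAt_id x).const_add 1).rpow_const (Or.inl (by simp; linarith [hx.1]))).sub
      (((hasDerivAt_id x).const_sub 1).rpow_const (Or.inl (by simp; linarith [hx.2])))).sub
      ((hasDerivAt_id x).const_mul (2 * r))
  have hm : MonotoneOn (fun y : ℝ => (1 + y) ^ r - (1 - y) ^ r - 2 * r * y) (Set.Icc 0 1) := by
    refine monotoneOn_of_deriv_nonneg (convex_Icc 0 1) ?_ ?_ ?_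
    · refine ContinuousOn.sub (ContinuousOn.sub ?_ ?_) (by fun_prop)
      · exact ContinuousOn.rpow_const (by fun_prop) fun x _ => Or.inr hr0.le
      · exact ContinuousOn.rpow_const (by fun_prop) fun x _ => Or.inr hr0.le
    · rw [interior_Icc]
      exact fun x hx => (hd x hx).differentiableAt.differentiableWithinAt
    · rw [interior_Icc]
      intro x hx
      rw [(hd x hx).deriv]
      have h1 : 0 < 1 + x := by linarith [hx.1]
      have h2 : 0 < 1 - x := by linarith [hx.2]
      have h3 : 1 ≤ (1 + x) ^ (r - 1) * (1 - x) ^ (r - 1) := by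
        rw [← Real.mul_rpow h1.le h2.le]
        exact Real.one_le_rpow_of_pos_of_le_one_of_nonpos (by positivity)
          (by nlinarith [sq_nonneg x]) (by linarith)
      have h4 : 0 < (1 + x) ^ (r - 1) := by positivity
      have h5 : 0 < (1 - x) ^ (r - 1) := by positivity
      have h6 : 2 ≤ (1 + x) ^ (r - 1) + (1 - x) ^ (r - 1) := by
        nlinarith [sq_nonneg ((1 + x) ^ (r - 1) - (1 - x) ^ (r - 1))]
      nlinarith
  have := hm (Set.left_mem_Icc.2 zero_le_one) ⟨hy0, hy1⟩ hy0
  simp at this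
  linarith

lemma one_add_mul_sq_le_rpow_mean {r y : ℝ} (hr0 : 0 < r) (hr1 : r < 1) (hy0 : 0 ≤ y)
    (hy1 : y ≤ 1) :
    1 + (1 + r) * r / 2 * y ^ 2 ≤ ((1 + y) ^ (1 + r) + (1 - y) ^ (1 + r)) / 2 := by
  have hd : ∀ x : ℝ, HasDerivAt
      (fun y : ℝ => (1 + y) ^ (1 + r) + (1 - y) ^ (1 + r) - (1 + r) * r * y ^ 2)
      (1 * (1 + r) * (1 + x) ^ (1 + r - 1) + (-1) * (1 + r) * (1 - x) ^ (1 + r - 1)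
        - (1 + r) * r * (((2 : ℕ) : ℝ) * x ^ (2 - 1))) x := fun x =>
    ((((hasDerivAt_id x).const_add 1).rpow_const (Or.inr (by linarith))).add
      (((hasDerivAt_id x).const_sub 1).rpow_const (Or.inr (by linarith)))).sub
      ((hasDerivAt_pow 2 x).const_mul ((1 + r) * r))
  have hm : MonotoneOn (fun y : ℝ => (1 + y) ^ (1 + r) + (1 - y) ^ (1 + r) - (1 + r) * r * y ^ 2)
      (Set.Icc 0 1) := by
    refine monotoneOn_of_deriv_nonneg (convex_Icc 0 1)
      (fun x _ => (hd x).continuousAt.continuousWithinAt)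
      (fun x _ => (hd x).differentiableAt.differentiableWithinAt) ?_
    rw [interior_Icc]
    intro x hx
    rw [(hd x).deriv]
    have := two_mul_mul_le_rpow_sub_rpow hr0 hr1 hx.1.le hx.2.le
    norm_num
    nlinarith
  have := hm (Set.left_mem_Icc.2 zero_le_one) ⟨hy0, hy1⟩ hy0
  simp at this
  linarith

/-- This says that the noise operator with parameter `√r` on one sign is a contraction from
`L^{1+r}` to `L²`. By homogeneity `m = 1`; Bernoulli's inequality with exponent `(1+r)/2 ≤ 1` then
reduces it to the second-order bound `one_add_mul_sq_le_rpow_mean`. -/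
lemma sq_add_mul_sq_le_rpow_mean {r m d : ℝ} (hr0 : 0 < r) (hr1 : r < 1) (hd : |d| ≤ m) :
    m ^ 2 + r * d ^ 2 ≤ ((((m + d) ^ (1 + r) + (m - d) ^ (1 + r)) / 2) ^ (1 / (1 + r))) ^ 2 := by
  wlog hd0 : 0 ≤ d generalizing d
  · have := this (d := -d) (by simpa using hd) (by linarith)
    simpa [← sub_eq_add_neg, add_comm] using this
  rw [abs_of_nonneg hd0] at hd
  rcases hd0.eq_or_lt with rfl | hd0
  · simp only [add_zero, sub_zero, add_self_div_two]
    rw [← Real.rpow_mul hd, mul_one_div_cancel (by linarith)]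
    simp
  have hm : 0 < m := hd0.trans_le hd
  set y := d / m with hy
  have hy0 : 0 ≤ y := by positivity
  have hy1 : y ≤ 1 := by rw [hy, div_le_one hm]; exact hd
  have e1 : m + d = m * (1 + y) := by rw [hy]; field_simp
  have e2 : m - d = m * (1 - y) := by rw [hy]; field_simp
  have e3 : d = m * y := by rw [hy]; field_simp
  rw [e1, e2, Real.mul_rpow hm.le (by linarith), Real.mul_rpow hm.le (by linarith), ← mul_add,
    mul_div_assoc, Real.mul_rpow (by positivity)
      (div_nonneg (add_nonneg (Real.rpow_nonneg (by linarith) _)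
        (Real.rpow_nonneg (by linarith) _)) (by norm_num)),
    ← Real.rpow_mul hm.le, mul_one_div_cancel (by linarith), Real.rpow_one, mul_pow, e3]
  have : m ^ 2 + r * (m * y) ^ 2 = m ^ 2 * (1 + r * y ^ 2) := by ring
  rw [this]
  gcongr
  have hp : (0 : ℝ) < 1 + r := by linarith
  have hB : (1 + r * y ^ 2) ^ ((1 + r) / 2) ≤ ((1 + y) ^ (1 + r) + (1 - y) ^ (1 + r)) / 2 := by
    refine le_trans (rpow_one_add_le_one_add_mul_self ?_ (by linarith) (by linarith))
      (le_trans (le_of_eq ?_) (one_add_mul_sq_le_rpow_mean hr0 hr1 hy0 hy1))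
    · nlinarith [mul_nonneg hr0.le (sq_nonneg y)]
    · ring
  have h0 : 0 ≤ 1 + r * y ^ 2 := by positivity
  calc 1 + r * y ^ 2 = (((1 + r * y ^ 2) ^ ((1 + r) / 2)) ^ (1 / (1 + r))) ^ 2 := by
        have : (1 + r) / 2 * (1 / (1 + r)) = 1 / 2 := by field_simp
        rw [← Real.rpow_mul h0, this, ← Real.sqrt_eq_rpow, Real.sq_sqrt h0]
    _ ≤ _ := by gcongr

/-- In terms of means and half-differences the left side is `m m' + r d d'`. Cauchy–Schwarz splits
`r` as `√r · √r`, and each factor is bounded by `sq_add_mul_sq_le_rpow_mean`. -/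
lemma two_point_hypercontractive {r a b c d : ℝ} (hr0 : 0 < r) (hr1 : r < 1) (ha : 0 ≤ a)
    (hb : 0 ≤ b) (hc : 0 ≤ c) (hd : 0 ≤ d) :
    (1 + r) / 4 * (a * c + b * d) + (1 - r) / 4 * (a * d + b * c) ≤
      ((a ^ (1 + r) + b ^ (1 + r)) / 2) ^ (1 / (1 + r)) *
        ((c ^ (1 + r) + d ^ (1 + r)) / 2) ^ (1 / (1 + r)) := by
  have key : ∀ {a b : ℝ}, 0 ≤ a → 0 ≤ b → ((a + b) / 2) ^ 2 + r * ((a - b) / 2) ^ 2 ≤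
      (((a ^ (1 + r) + b ^ (1 + r)) / 2) ^ (1 / (1 + r))) ^ 2 := by
    intro a b ha hb
    have := sq_add_mul_sq_le_rpow_mean (m := (a + b) / 2) (d := (a - b) / 2) hr0 hr1
      (by rw [abs_le]; constructor <;> linarith)
    convert! this using 6 <;> ring
  refine le_of_sq_le_sq ?_ (by positivity)
  rw [mul_pow]
  refine le_trans ?_ (mul_le_mul (key ha hb) (key hc hd) (by positivity) (by positivity))
  have : (1 + r) / 4 * (a * c + b * d) + (1 - r) / 4 * (a * d + b * c) =
    (a + b) / 2 * ((c + d) / 2) + r * ((a - b) / 2 * ((c - d) / 2)) := by ring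
  rw [this]
  nlinarith [mul_nonneg hr0.le
    (sq_nonneg ((a + b) / 2 * ((c - d) / 2) - (a - b) / 2 * ((c + d) / 2)))]

end TwoPoint

/-! ### Tensorization of bilinear hypercontractivity. -/

section Hypercontractive

/-- The pair `(X, Y)` is hypercontractive with exponent `p` on `(Ω, P)`. -/
def IsHypercontractive {Ω α β : Type*} [MeasurableSpace Ω] [MeasurableSpace α]
    [MeasurableSpace β] (P : Measure Ω) (X : Ω → α) (Y : Ω → β) (p : ℝ) : Prop :=
  ∀ (f : α → ℝ≥0∞) (g : β → ℝ≥0∞), Measurable f → Measurable g →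
    ∫⁻ ω, f (X ω) * g (Y ω) ∂P ≤
      (∫⁻ ω, f (X ω) ^ p ∂P) ^ (1 / p) * (∫⁻ ω, g (Y ω) ^ p ∂P) ^ (1 / p)

variable {Ω Ω' α β α' β' : Type*} [MeasurableSpace Ω] [MeasurableSpace Ω'] [MeasurableSpace α]
  [MeasurableSpace β] [MeasurableSpace α'] [MeasurableSpace β'] {P : Measure Ω} {Q : Measure Ω'}
  {X : Ω → α} {Y : Ω → β} {X' : Ω' → α'} {Y' : Ω' → β'} {p : ℝ}

lemma IsHypercontractive.comp (h : IsHypercontractive P X Y p) {φ : α → α'} {ψ : β → β'}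
    (hφ : Measurable φ) (hψ : Measurable ψ) :
    IsHypercontractive P (fun ω => φ (X ω)) (fun ω => ψ (Y ω)) p :=
  fun f g hf hg => h (f ∘ φ) (g ∘ ψ) (hf.comp hφ) (hg.comp hψ)

lemma IsHypercontractive.comp_measurePreserving (h : IsHypercontractive P X Y p)
    (hX : Measurable X) (hY : Measurable Y) {e : Ω' → Ω} (he : MeasurePreserving e Q P) :
    IsHypercontractive Q (fun ω => X (e ω)) (fun ω => Y (e ω)) p := by
  intro f g hf hg
  have := h f g hf hg
  rw [← he.map_eq, lintegral_map (by fun_prop) he.measurable,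
    lintegral_map (by fun_prop) he.measurable, lintegral_map (by fun_prop) he.measurable] at this
  exact this

/-- The inequality for the second pair, applied on each fibre, leaves a product of `L^p` norms of
slices, one a function of `X` and the other of `Y`. The inequality for the first pair applies to
these, and the powers `1/p` and `p` cancel. -/
lemma IsHypercontractive.prod [SFinite Q] (hp : 0 < p)
    (h : IsHypercontractive P X Y p) (h' : IsHypercontractive Q X' Y' p)
    (hX : Measurable X) (hY : Measurable Y) (hX' : Measurable X') (hY' : Measurable Y') :
    IsHypercontractive (P.prod Q) (fun ω => (X ω.1, X' ω.2)) (fun ω => (Y ω.1, Y' ω.2)) p := by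
  intro f g hf hg
  rw [lintegral_prod _ (by fun_prop), lintegral_prod _ (by fun_prop),
    lintegral_prod _ (by fun_prop)]
  have hF : Measurable fun a => ∫⁻ ω', f (a, X' ω') ^ p ∂Q :=
    Measurable.lintegral_prod_right' (f := fun z : α × Ω' => f (z.1, X' z.2) ^ p) (by fun_prop)
  have hG : Measurable fun a => ∫⁻ ω', g (a, Y' ω') ^ p ∂Q :=
    Measurable.lintegral_prod_right' (f := fun z : β × Ω' => g (z.1, Y' z.2) ^ p) (by fun_prop)
  refine (lintegral_mono fun ω => h' (fun b => f (X ω, b)) (fun b => g (Y ω, b))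
    (by fun_prop) (by fun_prop)).trans ?_
  refine (h (fun a => (∫⁻ ω', f (a, X' ω') ^ p ∂Q) ^ (1 / p))
    (fun a => (∫⁻ ω', g (a, Y' ω') ^ p ∂Q) ^ (1 / p)) (hF.pow_const _) (hG.pow_const _)).trans ?_
  simp only [← ENNReal.rpow_mul, one_div_mul_cancel hp.ne', ENNReal.rpow_one, le_refl]

lemma IsHypercontractive.pi [IsProbabilityMeasure P] (hp : 1 ≤ p)
    (h : IsHypercontractive P X Y p) (hX : Measurable X) (hY : Measurable Y) (n : ℕ) :
    IsHypercontractive (Measure.pi fun _ : Fin n => P) (fun ω i => X (ω i)) (fun ω i => Y (ω i))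
      p := by
  have hp0 : 0 < p := by linarith
  induction n with
  | zero =>
    intro f g hf hg
    have e : ∀ (ω : Fin 0 → Ω), ω = default := fun ω => Subsingleton.elim _ _
    simp only [e, Subsingleton.elim (fun i : Fin 0 => X ((default : Fin 0 → Ω) i)) default,
      Subsingleton.elim (fun i : Fin 0 => Y ((default : Fin 0 → Ω) i)) default, lintegral_const,
      measure_univ, mul_one, ← ENNReal.rpow_mul, mul_one_div_cancel hp0.ne', ENNReal.rpow_one,
      le_refl]
  | succ n ih =>
    have h1 := h.prod hp0 ih hX hY (by fun_prop) (by fun_prop)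
    have h2 := h1.comp (φ := (MeasurableEquiv.piFinSuccAbove (fun _ => α) 0).symm)
      (ψ := (MeasurableEquiv.piFinSuccAbove (fun _ => β) 0).symm)
      (MeasurableEquiv.measurable _) (MeasurableEquiv.measurable _)
    have h3 := h2.comp_measurePreserving
      (by fun_prop) (by fun_prop)
      (measurePreserving_piFinSuccAbove (fun _ : Fin (n + 1) => P) 0)
    convert! h3 using 2 with ω ω
    · ext i; refine Fin.cases ?_ (fun j => ?_) i <;> simp [MeasurableEquiv.piFinSuccAbove, Fin.tail]
    · ext i; refine Fin.cases ?_ (fun j => ?_) i <;> simp [MeasurableEquiv.piFinSuccAbove, Fin.tail]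

end Hypercontractive

/-! ### Correlated signs: hypercontractivity and asymptotics of the characteristic function. -/

section SignPair

/-- The joint law of two uniform signs with correlation `r`. -/
noncomputable def signPair (r : ℝ) : Measure (ℝ × ℝ) :=
  ENNReal.ofReal ((1 + r) / 4) • (Measure.dirac (1, 1) + Measure.dirac (-1, -1)) +
    ENNReal.ofReal ((1 - r) / 4) • (Measure.dirac (1, -1) + Measure.dirac (-1, 1))

lemma lintegral_signPair (r : ℝ) (f : ℝ × ℝ → ℝ≥0∞) :
    ∫⁻ z, f z ∂signPair r = ENNReal.ofReal ((1 + r) / 4) * (f (1, 1) + f (-1, -1)) +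
      ENNReal.ofReal ((1 - r) / 4) * (f (1, -1) + f (-1, 1)) := by
  simp [signPair, lintegral_add_measure, lintegral_smul_measure, lintegral_dirac, mul_add]

lemma isProbabilityMeasure_signPair {r : ℝ} (hr0 : 0 < r) (hr1 : r < 1) :
    IsProbabilityMeasure (signPair r) := by
  refine ⟨?_⟩
  rw [← lintegral_one, lintegral_signPair, one_add_one_eq_two, ← add_mul,
    ← ENNReal.ofReal_add (by linarith) (by linarith),
    show (2 : ℝ≥0∞) = ENNReal.ofReal 2 by simp, ← ENNReal.ofReal_mul (by linarith)]
  ring_nf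
  simp

lemma integral_signPair {r : ℝ} (hr0 : 0 < r) (hr1 : r < 1) (f : ℝ × ℝ → ℂ) :
    ∫ z, f z ∂signPair r = (1 + r) / 4 * (f (1, 1) + f (-1, -1)) +
      (1 - r) / 4 * (f (1, -1) + f (-1, 1)) := by
  have hi : ∀ z, Integrable f (Measure.dirac z) := fun z => integrable_dirac (by simp)
  rw [signPair, integral_add_measure
      (((hi _).add_measure (hi _)).smul_measure (by simp))
      (((hi _).add_measure (hi _)).smul_measure (by simp)),
    integral_smul_measure, integral_smul_measure, integral_add_measure (hi _) (hi _),
    integral_add_measure (hi _) (hi _)]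
  simp only [integral_dirac]
  rw [ENNReal.toReal_ofReal (by linarith), ENNReal.toReal_ofReal (by linarith)]
  simp only [Complex.real_smul]
  push_cast
  rfl

lemma ennreal_two_point_hypercontractive {r : ℝ} (hr0 : 0 < r) (hr1 : r < 1) (a b c d : ℝ≥0∞) :
    ENNReal.ofReal ((1 + r) / 4) * (a * c + b * d) +
        ENNReal.ofReal ((1 - r) / 4) * (a * d + b * c) ≤
      (ENNReal.ofReal (1 / 2) * (a ^ (1 + r) + b ^ (1 + r))) ^ (1 / (1 + r)) *
        (ENNReal.ofReal (1 / 2) * (c ^ (1 + r) + d ^ (1 + r))) ^ (1 / (1 + r)) := by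
  have hp : (0 : ℝ) < 1 + r := by linarith
  have hp' : (0 : ℝ) < 1 / (1 + r) := by positivity
  have top : ∀ {a b : ℝ≥0∞}, a = ⊤ ∨ b = ⊤ →
      (ENNReal.ofReal (1 / 2) * (a ^ (1 + r) + b ^ (1 + r))) ^ (1 / (1 + r)) = ⊤ := by
    rintro a b (rfl | rfl) <;>
      simp [ENNReal.top_rpow_of_pos hp, ENNReal.mul_top, ENNReal.top_rpow_of_pos (inv_pos.2 hp)]
  have zero : ∀ {a b : ℝ≥0∞},
      (ENNReal.ofReal (1 / 2) * (a ^ (1 + r) + b ^ (1 + r))) ^ (1 / (1 + r)) = 0 →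
      a = 0 ∧ b = 0 := by
    intro a b h
    rw [ENNReal.rpow_eq_zero_iff_of_pos hp', mul_eq_zero, add_eq_zero,
      ENNReal.rpow_eq_zero_iff_of_pos hp, ENNReal.rpow_eq_zero_iff_of_pos hp] at h
    rcases h with h | h
    · norm_num at h
    · exact h
  -- With an infinite value the right side is `⊤`, unless the other factor is 0; in that case both
  -- values of the other function are 0 and so is the left side.
  by_cases hab : a = ⊤ ∨ b = ⊤
  · by_cases h0 : (ENNReal.ofReal (1 / 2) * (c ^ (1 + r) + d ^ (1 + r))) ^ (1 / (1 + r)) = 0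
    · obtain ⟨rfl, rfl⟩ := zero h0
      simp
    · rw [top hab, ENNReal.top_mul h0]; exact le_top
  by_cases hcd : c = ⊤ ∨ d = ⊤
  · by_cases h0 : (ENNReal.ofReal (1 / 2) * (a ^ (1 + r) + b ^ (1 + r))) ^ (1 / (1 + r)) = 0
    · obtain ⟨rfl, rfl⟩ := zero h0
      simp
    · rw [top hcd, ENNReal.mul_top h0]; exact le_top
  push Not at hab hcd
  have fin : ∀ {a b : ℝ≥0∞}, a ≠ ⊤ ∧ b ≠ ⊤ → ∃ x y : ℝ, 0 ≤ x ∧ 0 ≤ y ∧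
      a = ENNReal.ofReal x ∧ b = ENNReal.ofReal y := fun {a b} h =>
    ⟨a.toReal, b.toReal, by simp, by simp, by simp [h.1], by simp [h.2]⟩
  obtain ⟨a, b, ha, hb, rfl, rfl⟩ := fin hab
  obtain ⟨c, d, hc, hd, rfl, rfl⟩ := fin hcd
  have e : ∀ {a b : ℝ}, 0 ≤ a → 0 ≤ b →
      (ENNReal.ofReal (1 / 2) * (ENNReal.ofReal a ^ (1 + r) + ENNReal.ofReal b ^ (1 + r))) ^
        (1 / (1 + r)) = ENNReal.ofReal (((a ^ (1 + r) + b ^ (1 + r)) / 2) ^ (1 / (1 + r))) := by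
    intro a b ha hb
    rw [ENNReal.ofReal_rpow_of_nonneg ha hp.le, ENNReal.ofReal_rpow_of_nonneg hb hp.le,
      ← ENNReal.ofReal_add (by positivity) (by positivity), ← ENNReal.ofReal_mul (by norm_num),
      ENNReal.ofReal_rpow_of_nonneg (by positivity) hp'.le]
    congr 2; ring
  rw [e ha hb, e hc hd, ← ENNReal.ofReal_mul ha, ← ENNReal.ofReal_mul ha, ← ENNReal.ofReal_mul hb,
    ← ENNReal.ofReal_mul hb, ← ENNReal.ofReal_add (by positivity) (by positivity),
    ← ENNReal.ofReal_add (by positivity) (by positivity), ← ENNReal.ofReal_mul (by linarith),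
    ← ENNReal.ofReal_mul (by linarith),
    ← ENNReal.ofReal_add (mul_nonneg (by linarith) (by positivity))
      (mul_nonneg (by linarith) (by positivity)),
    ← ENNReal.ofReal_mul (by positivity)]
  exact ENNReal.ofReal_le_ofReal (two_point_hypercontractive hr0 hr1 ha hb hc hd)

lemma isHypercontractive_signPair {r : ℝ} (hr0 : 0 < r) (hr1 : r < 1) :
    IsHypercontractive (signPair r) Prod.fst Prod.snd (1 + r) := by
  intro f g _ _
  have h := ennreal_two_point_hypercontractive hr0 hr1 (f 1) (f (-1)) (g 1) (g (-1))
  have e : ENNReal.ofReal (1 / 2) = ENNReal.ofReal ((1 + r) / 4) + ENNReal.ofReal ((1 - r) / 4) := by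
    rw [← ENNReal.ofReal_add (by linarith) (by linarith)]
    congr 1; ring
  simp only [lintegral_signPair]
  convert! h using 3
  · rw [e]; ring
  · rw [e]; ring

lemma isLittleO_cos_div_sqrt (c : ℝ) :
    (fun N : ℕ => Real.cos ((√N)⁻¹ * c) - (1 - c ^ 2 / 2 / N)) =o[atTop]
      fun N : ℕ => 1 / (N : ℝ) := by
  have h : (fun N : ℕ => Real.cos ((√N)⁻¹ * c) - (1 - c ^ 2 / 2 / N)) =O[atTop]
      fun N : ℕ => (1 / (N : ℝ)) * (1 / (N : ℝ)) := by
    -- `Real.cos_bound` gives the error `x⁴ · 5/96` for `|x| ≤ 1`, which holds at `x = c/√N` as soon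
    -- as `N ≥ c²`.
    refine Asymptotics.IsBigO.of_bound (c ^ 4 * (5 / 96)) ?_
    filter_upwards [eventually_ge_atTop (⌈c ^ 2⌉₊ + 1)] with N hN
    have hN0 : (0 : ℝ) < N := by exact_mod_cast (Nat.succ_pos _).trans_le hN
    have hN1 : c ^ 2 ≤ N := (Nat.le_ceil _).trans (by exact_mod_cast (Nat.le_succ _).trans hN)
    have hsq : ((√N)⁻¹ * c) ^ 2 = c ^ 2 / N := by
      rw [mul_pow, inv_pow, Real.sq_sqrt hN0.le]; ring
    have hle : |(√N)⁻¹ * c| ≤ 1 := by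
      rw [← sq_le_one_iff_abs_le_one, hsq, div_le_one hN0]; exact hN1
    have := Real.cos_bound hle
    rw [hsq] at this
    have h4 : |(√N)⁻¹ * c| ^ 4 = c ^ 4 * (1 / N * (1 / N)) := by
      rw [show (4 : ℕ) = 2 * 2 by norm_num, pow_mul, sq_abs, hsq]; ring
    rw [h4] at this
    rw [Real.norm_eq_abs, Real.norm_eq_abs, abs_of_pos (by positivity : 0 < 1 / (N : ℝ) * (1 / N))]
    convert! this using 1
    · congr 1; ring
    · ring
  refine h.trans_isLittleO ?_
  have : (fun N : ℕ => 1 / (N : ℝ)) =o[atTop] fun _ => (1 : ℝ) :=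
    (Asymptotics.isLittleO_one_iff ℝ).2 tendsto_one_div_atTop_nhds_zero_nat
  simpa using this.mul_isBigO (Asymptotics.isBigO_refl (fun N : ℕ => 1 / (N : ℝ)) atTop)

lemma integral_exp_signPair {r : ℝ} (hr0 : 0 < r) (hr1 : r < 1) (a b : ℝ) :
    ∫ z, Complex.exp (((z.1 * a + z.2 * b : ℝ) : ℂ) * Complex.I) ∂signPair r =
      (((1 + r) / 2 * Real.cos (a + b) + (1 - r) / 2 * Real.cos (a - b) : ℝ) : ℂ) := by
  rw [integral_signPair hr0 hr1]
  push_cast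
  simp only [Complex.cos]
  ring_nf

/-- The exponent comes from expanding both cosines to second order: `(1+r)/4 · (a+b)² + (1-r)/4 ·
(a-b)² = (a² + 2rab + b²)/2`. -/
lemma tendsto_integral_exp_signPair_pow {r : ℝ} (hr0 : 0 < r) (hr1 : r < 1) (a b : ℝ) :
    Tendsto (fun N : ℕ => (∫ z, Complex.exp
      (((z.1 * ((√N)⁻¹ * a) + z.2 * ((√N)⁻¹ * b) : ℝ) : ℂ) * Complex.I) ∂signPair r) ^ N) atTop
      (𝓝 (Complex.exp ((-(a ^ 2 + 2 * r * a * b + b ^ 2) / 2 : ℝ) : ℂ))) := by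
  refine Complex.tendsto_pow_exp_of_isLittleO_sub_add_div _ ?_
  have h := ((isLittleO_cos_div_sqrt (a + b)).const_mul_left ((1 + r) / 2)).add
    ((isLittleO_cos_div_sqrt (a - b)).const_mul_left ((1 - r) / 2))
  rw [← Asymptotics.isLittleO_norm_left, ← Asymptotics.isLittleO_norm_right] at h ⊢
  refine (h.congr (fun N => ?_) fun N => ?_)
  · rw [integral_exp_signPair hr0 hr1, ← Complex.norm_real]
    congr 1
    push_cast
    ring_nf
  · rw [← Complex.norm_real]; push_cast; rfl

end SignPair

/-! ### Central limit theorem and Gaussian hypercontractivity. -/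

section GaussianHypercontractive

/-- The normalised sum of `N` independent correlated sign vectors of length `n`. -/
noncomputable def signSum (n N : ℕ) (ω : Fin N → Fin n → ℝ) : 𝔼 n :=
  (√N)⁻¹ • ∑ k, WithLp.toLp 2 (ω k)

lemma measurable_signSum (n N : ℕ) : Measurable (signSum n N) := by
  unfold signSum
  fun_prop

/-- The joint law of the normalised sums of `N` independent correlated pairs of sign vectors. -/
noncomputable def signSumLaw (r : ℝ) (n N : ℕ) : Measure (WithLp 2 ((𝔼 n) × (𝔼 n))) :=
  (Measure.pi fun _ : Fin N => Measure.pi fun _ : Fin n => signPair r).map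
    fun ω => WithLp.toLp 2 (signSum n N fun k j => (ω k j).1, signSum n N fun k j => (ω k j).2)

lemma measurable_signSum_pair (n N : ℕ) : Measurable fun ω : Fin N → Fin n → ℝ × ℝ =>
    WithLp.toLp 2 (signSum n N fun k j => (ω k j).1, signSum n N fun k j => (ω k j).2) := by
  have := measurable_signSum n N
  fun_prop

lemma isProbabilityMeasure_signSumLaw {r : ℝ} (hr0 : 0 < r) (hr1 : r < 1) (n N : ℕ) :
    IsProbabilityMeasure (signSumLaw r n N) := by
  have := isProbabilityMeasure_signPair hr0 hr1
  exact Measure.isProbabilityMeasure_map (measurable_signSum_pair n N).aemeasurable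

lemma isHypercontractive_signSumLaw {r : ℝ} (hr0 : 0 < r) (hr1 : r < 1) (n N : ℕ) :
    IsHypercontractive (signSumLaw r n N) (fun z => z.fst) (fun z => z.snd) (1 + r) := by
  have := isProbabilityMeasure_signPair hr0 hr1
  have h := (((isHypercontractive_signPair hr0 hr1).pi (by linarith) measurable_fst measurable_snd
    n).pi (by linarith) (by fun_prop) (by fun_prop) N).comp (measurable_signSum n N)
      (measurable_signSum n N)
  intro f g hf hg
  have h2 := measurable_signSum_pair n N
  rw [signSumLaw, lintegral_map (by fun_prop) h2, lintegral_map (by fun_prop) h2,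
    lintegral_map (by fun_prop) h2]
  exact h f g hf hg

lemma charFun_signSumLaw {r : ℝ} (hr0 : 0 < r) (hr1 : r < 1) (n N : ℕ)
    (t : WithLp 2 ((𝔼 n) × (𝔼 n))) :
    charFun (signSumLaw r n N) t = ∏ j : Fin n, (∫ z, Complex.exp
      (((z.1 * ((√N)⁻¹ * t.fst j) + z.2 * ((√N)⁻¹ * t.snd j) : ℝ) : ℂ) * Complex.I)
        ∂signPair r) ^ N := by
  have := isProbabilityMeasure_signPair hr0 hr1
  rw [charFun_apply, signSumLaw, integral_map (measurable_signSum_pair n N).aemeasurable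
    (by fun_prop), Finset.prod_pow, ← integral_fintype_prod_eq_prod (ι := Fin n)
      (f := fun j (z : ℝ × ℝ) => Complex.exp
      (((z.1 * ((√N)⁻¹ * t.fst j) + z.2 * ((√N)⁻¹ * t.snd j) : ℝ) : ℂ) * Complex.I)),
    ← Fintype.card_fin N, ← integral_fintype_prod_eq_pow (ι := Fin N), Fintype.card_fin]
  congr 1
  ext ω
  simp only [← Complex.exp_sum, ← Finset.sum_mul, ← Complex.ofReal_sum]
  congr 3
  simp only [WithLp.prod_inner_apply, signSum, inner_smul_left, sum_inner, PiLp.inner_apply]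
  simp [Finset.mul_sum, ← Finset.sum_add_distrib]
  refine Finset.sum_congr rfl fun k _ => Finset.sum_congr rfl fun j _ => ?_
  ring

/-- The joint law of two standard Gaussian vectors with correlation `cos θ`. -/
noncomputable def gaussPair (n : ℕ) (θ : ℝ) : Measure (WithLp 2 ((𝔼 n) × (𝔼 n))) :=
  ((stdGaussMeasure n).prod (stdGaussMeasure n)).map
    fun z => WithLp.toLp 2 (z.1, Real.cos θ • z.1 + Real.sin θ • z.2)

lemma measurable_gaussPair_map (n : ℕ) (θ : ℝ) : Measurable fun z : (𝔼 n) × (𝔼 n) =>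
    WithLp.toLp 2 (z.1, Real.cos θ • z.1 + Real.sin θ • z.2) := by fun_prop

instance isProbabilityMeasure_gaussPair (n : ℕ) (θ : ℝ) : IsProbabilityMeasure (gaussPair n θ) :=
  Measure.isProbabilityMeasure_map (measurable_gaussPair_map n θ).aemeasurable

lemma charFun_gaussPair (n : ℕ) (θ : ℝ) (t : WithLp 2 ((𝔼 n) × (𝔼 n))) :
    charFun (gaussPair n θ) t = ∏ j : Fin n, Complex.exp ((-(t.fst j ^ 2 +
      2 * Real.cos θ * t.fst j * t.snd j + t.snd j ^ 2) / 2 : ℝ) : ℂ) := by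
  have h : ∀ z : (𝔼 n) × (𝔼 n), Complex.exp ((inner ℝ
      (WithLp.toLp 2 (z.1, Real.cos θ • z.1 + Real.sin θ • z.2)) t : ℂ) * Complex.I) =
      Complex.exp ((inner ℝ z.1 (t.fst + Real.cos θ • t.snd) : ℂ) * Complex.I) *
      Complex.exp ((inner ℝ z.2 (Real.sin θ • t.snd) : ℂ) * Complex.I) := by
    intro z
    rw [← Complex.exp_add, ← add_mul, ← Complex.ofReal_add]
    congr 3
    simp only [WithLp.prod_inner_apply, inner_add_left, inner_add_right, inner_smul_left,
      inner_smul_right]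
    simp
    ring
  rw [charFun_apply, gaussPair, integral_map (measurable_gaussPair_map n θ).aemeasurable
    (by fun_prop)]
  simp_rw [h]
  rw [integral_prod_mul (fun x : 𝔼 n => Complex.exp
      ((inner ℝ x (t.fst + Real.cos θ • t.snd) : ℂ) * Complex.I))
    (fun x : 𝔼 n => Complex.exp ((inner ℝ x (Real.sin θ • t.snd) : ℂ) * Complex.I)),
    ← charFun_apply, ← charFun_apply, charFun_stdGaussian, charFun_stdGaussian, ← Complex.exp_add,
    ← Complex.exp_sum]
  congr 1
  rw [← Complex.ofReal_sum]
  norm_cast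
  simp only [EuclideanSpace.real_norm_sq_eq, ← Finset.sum_neg_distrib, Finset.sum_div,
    ← Finset.sum_add_distrib]
  refine Finset.sum_congr rfl fun j _ => ?_
  simp
  linear_combination (-(t.snd j) ^ 2 / 2) * Real.sin_sq_add_cos_sq θ

/-- The central limit theorem for correlated sign vectors: characteristic functions converge factor
by factor, and Lévy's continuity theorem gives weak convergence. -/
lemma tendsto_lintegral_signSumLaw {n : ℕ} {θ : ℝ} (h0 : 0 < Real.cos θ) (h1 : Real.cos θ < 1)
    (f : BoundedContinuousFunction (WithLp 2 ((𝔼 n) × (𝔼 n))) ℝ≥0) :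
    Tendsto (fun N => ∫⁻ z, f z ∂signSumLaw (Real.cos θ) n N) atTop
      (𝓝 (∫⁻ z, f z ∂gaussPair n θ)) := by
  have hP := fun N => isProbabilityMeasure_signSumLaw h0 h1 n N
  let ν : ℕ → ProbabilityMeasure (WithLp 2 ((𝔼 n) × (𝔼 n))) :=
    fun N => ⟨signSumLaw (Real.cos θ) n N, hP N⟩
  let ν₀ : ProbabilityMeasure (WithLp 2 ((𝔼 n) × (𝔼 n))) := ⟨gaussPair n θ, inferInstance⟩
  have h : Tendsto ν atTop (𝓝 ν₀) := by
    refine ProbabilityMeasure.tendsto_iff_tendsto_charFun.2 fun t => ?_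
    change Tendsto (fun N => charFun (signSumLaw (Real.cos θ) n N) t) atTop
      (𝓝 (charFun (gaussPair n θ) t))
    simp only [charFun_signSumLaw h0 h1, charFun_gaussPair]
    exact tendsto_finsetProd _ fun j _ => tendsto_integral_exp_signPair_pow h0 h1 _ _
  exact ProbabilityMeasure.tendsto_iff_forall_lintegral_tendsto.1 h f

/-- Hypercontractivity for the Gaussian pair and bounded continuous functions. -/
lemma lintegral_gaussPair_le_of_bounded {n : ℕ} {θ : ℝ} (h0 : 0 < Real.cos θ)
    (h1 : Real.cos θ < 1) (f : (𝔼 n) → ℝ≥0) (hf : Continuous f) (M : ℝ≥0) (hM : ∀ x, f x ≤ M) :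
    ∫⁻ z, f z.fst * f z.snd ∂gaussPair n θ ≤
      (∫⁻ z, (f z.fst : ℝ≥0∞) ^ (1 + Real.cos θ) ∂gaussPair n θ) ^ (1 / (1 + Real.cos θ)) *
      (∫⁻ z, (f z.snd : ℝ≥0∞) ^ (1 + Real.cos θ) ∂gaussPair n θ) ^ (1 / (1 + Real.cos θ)) := by
  set p := 1 + Real.cos θ with hp
  have hp0 : 0 < p := by linarith
  have hp1 : 0 < 1 / p := by positivity
  have key : ∀ g : WithLp 2 ((𝔼 n) × (𝔼 n)) → ℝ≥0, Continuous g → (∃ K, ∀ z, g z ≤ K) →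
      Tendsto (fun N => ∫⁻ z, g z ∂signSumLaw (Real.cos θ) n N) atTop
      (𝓝 (∫⁻ z, g z ∂gaussPair n θ)) := by
    rintro g hg ⟨K, hK⟩
    have hb : ∀ x y, dist (g x) (g y) ≤ K := fun x y => by
      rw [NNReal.dist_eq, abs_le]
      have h1 := NNReal.coe_le_coe.2 (hK x)
      have h2 := NNReal.coe_le_coe.2 (hK y)
      constructor <;> linarith [(g x).2, (g y).2, NNReal.coe_nonneg (g x), NNReal.coe_nonneg (g y)]
    exact tendsto_lintegral_signSumLaw h0 h1 (BoundedContinuousFunction.mkOfBound ⟨g, hg⟩ K hb)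
  have hcp : ∀ g : WithLp 2 ((𝔼 n) × (𝔼 n)) → ℝ≥0, Continuous g → (∃ K, ∀ z, g z ≤ K) →
      Tendsto (fun N => (∫⁻ z, (g z : ℝ≥0∞) ^ p ∂signSumLaw (Real.cos θ) n N) ^ (1 / p)) atTop
        (𝓝 ((∫⁻ z, (g z : ℝ≥0∞) ^ p ∂gaussPair n θ) ^ (1 / p))) := by
    rintro g hg ⟨K, hK⟩
    have := key (fun z => g z ^ p) (by fun_prop (disch := positivity))
      ⟨K ^ p, fun z => NNReal.rpow_le_rpow (hK z) hp0.le⟩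
    simp only [ENNReal.coe_rpow_of_nonneg _ hp0.le] at this
    exact (ENNReal.continuous_rpow_const.tendsto _).comp this
  -- Finiteness is needed to pass to the limit in the product of norms, since multiplication on
  -- `ℝ≥0∞` is not continuous at `(0, ⊤)`.
  have hfin : ∀ g : WithLp 2 ((𝔼 n) × (𝔼 n)) → ℝ≥0, (∃ K, ∀ z, g z ≤ K) →
      (∫⁻ z, (g z : ℝ≥0∞) ^ p ∂gaussPair n θ) ^ (1 / p) ≠ ⊤ := by
    rintro g ⟨K, hK⟩
    refine ENNReal.rpow_ne_top_of_nonneg hp1.le (ne_top_of_le_ne_top (b := (K : ℝ≥0∞) ^ p) ?_ ?_)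
    · exact ENNReal.rpow_ne_top_of_nonneg hp0.le (by simp)
    · refine (lintegral_mono fun z => ENNReal.rpow_le_rpow
        (ENNReal.coe_le_coe.2 (hK z)) hp0.le).trans ?_
      simp
  have hl := key (fun z => f z.fst * f z.snd) (by fun_prop)
    ⟨M * M, fun z => mul_le_mul' (hM _) (hM _)⟩
  have c1 := hcp (fun z => f z.fst) (by fun_prop) ⟨M, fun z => hM _⟩
  have c2 := hcp (fun z => f z.snd) (by fun_prop) ⟨M, fun z => hM _⟩
  simp only [ENNReal.coe_mul] at hl
  refine le_of_tendsto_of_tendsto' hl (ENNReal.Tendsto.mul c1 (Or.inr (hfin _ ⟨M, fun z => hM _⟩))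
    c2 (Or.inr (hfin _ ⟨M, fun z => hM _⟩))) fun N => ?_
  exact isHypercontractive_signSumLaw h0 h1 n N (fun x => f x) (fun x => f x)
    hf.measurable.coe_nnreal_ennreal hf.measurable.coe_nnreal_ennreal

/-- Two independent standard Gaussian vectors may be rotated into each other. This fixes the law of
`cos θ • X + sin θ • Z`, and it is the change of variables behind the derivative of `gaussCov`. -/
lemma measurePreserving_rotation (n : ℕ) (θ : ℝ) :
    MeasurePreserving (ContinuousLinearMap.rotation θ : (𝔼 n) × (𝔼 n) → (𝔼 n) × (𝔼 n))
      ((stdGaussMeasure n).prod (stdGaussMeasure n))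
      ((stdGaussMeasure n).prod (stdGaussMeasure n)) :=
  ⟨(ContinuousLinearMap.rotation θ).continuous.measurable,
    IsGaussian.map_rotation_eq_self (by simp [id]) θ⟩

lemma measurePreserving_correlated (n : ℕ) (θ : ℝ) :
    MeasurePreserving (fun z : (𝔼 n) × (𝔼 n) => Real.cos θ • z.1 + Real.sin θ • z.2)
      ((stdGaussMeasure n).prod (stdGaussMeasure n)) (stdGaussMeasure n) :=
  measurePreserving_fst.comp (measurePreserving_rotation n θ)

/-- **Gaussian hypercontractivity** in bilinear form. -/
theorem lintegral_correlated_le {n : ℕ} {θ : ℝ} (h0 : 0 < Real.cos θ) (h1 : Real.cos θ < 1)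
    (f : (𝔼 n) → ℝ≥0) (hf : Continuous f) :
    ∫⁻ z, f z.1 * f (Real.cos θ • z.1 + Real.sin θ • z.2)
        ∂((stdGaussMeasure n).prod (stdGaussMeasure n)) ≤
      (∫⁻ x, (f x : ℝ≥0∞) ^ (1 + Real.cos θ) ∂stdGaussMeasure n) ^ (2 / (1 + Real.cos θ)) := by
  set p := 1 + Real.cos θ with hp
  have hp0 : 0 < p := by linarith
  have hm := hf.measurable
  -- Truncation at level `M` gives the bounded case, with a right side already independent of `M`;
  -- monotone convergence then removes the truncation on the left.
  have main : ∀ M : ℕ, ∫⁻ z, (min (f z.1) M : ℝ≥0) *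
      (min (f (Real.cos θ • z.1 + Real.sin θ • z.2)) M : ℝ≥0)
        ∂((stdGaussMeasure n).prod (stdGaussMeasure n)) ≤
      (∫⁻ x, (f x : ℝ≥0∞) ^ p ∂stdGaussMeasure n) ^ (2 / p) := by
    intro M
    have h := lintegral_gaussPair_le_of_bounded h0 h1 (fun x => min (f x) M) (by fun_prop) M
      (fun x => min_le_right _ _)
    have hT := measurable_gaussPair_map n θ
    rw [gaussPair, lintegral_map (by fun_prop) hT, lintegral_map (by fun_prop) hT,
      lintegral_map (by fun_prop) hT] at h
    have e1 := (measurePreserving_fst (μ := stdGaussMeasure n)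
      (ν := stdGaussMeasure n)).lintegral_comp
      (f := fun x => (((min (f x) M : ℝ≥0) : ℝ≥0∞)) ^ p) (by fun_prop)
    have e2 := (measurePreserving_correlated n θ).lintegral_comp
      (f := fun x => (((min (f x) M : ℝ≥0) : ℝ≥0∞)) ^ p) (by fun_prop)
    refine h.trans (le_of_eq_of_le
      (congrArg₂ (fun a b : ℝ≥0∞ => a ^ (1 / p) * b ^ (1 / p)) e1 e2) ?_)
    rw [← ENNReal.rpow_add_of_nonneg _ _ (by positivity) (by positivity), ← add_div,
      one_add_one_eq_two]
    refine ENNReal.rpow_le_rpow (lintegral_mono fun x => ENNReal.rpow_le_rpow ?_ hp0.le)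
      (by positivity)
    exact ENNReal.coe_le_coe.2 (min_le_left _ _)
  have lim : ∀ x, Tendsto (fun M : ℕ => ((min (f x) M : ℝ≥0) : ℝ≥0∞)) atTop (𝓝 (f x)) := by
    intro x
    refine tendsto_const_nhds.congr' ?_
    filter_upwards [eventually_ge_atTop ⌈f x⌉₊] with M hM
    rw [min_eq_left ((Nat.le_ceil _).trans (by exact_mod_cast hM))]
  refine le_of_tendsto' (lintegral_tendsto_of_tendsto_of_monotone (fun M => by fun_prop)
    (ae_of_all _ fun z => ?_) (ae_of_all _ fun z => ENNReal.Tendsto.mul (lim z.1)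
      (Or.inr (by simp)) (lim _) (Or.inr (by simp)))) main
  intro M M' hMM
  have : (M : ℝ≥0) ≤ M' := by exact_mod_cast hMM
  dsimp only
  gcongr

end GaussianHypercontractive

/-! ### Gaussian integration by parts. -/

section GaussianIntegrationByParts

lemma integrable_gaussianReal_iff {f : ℝ → ℝ} :
    Integrable f (gaussianReal 0 1) ↔ Integrable (fun t => gaussianPDFReal 0 1 t * f t) := by
  rw [gaussianReal_of_var_ne_zero 0 one_ne_zero,
    integrable_withDensity_iff_integrable_smul' (measurable_gaussianPDF _ _)
      (ae_of_all _ fun _ => gaussianPDF_lt_top)]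
  simp

lemma hasDerivAt_gaussianPDFReal (t : ℝ) :
    HasDerivAt (gaussianPDFReal 0 1) (-t * gaussianPDFReal 0 1 t) t := by
  have h : HasDerivAt (fun t : ℝ => -(t - 0) ^ 2 / (2 * ((1 : ℝ≥0) : ℝ))) (-t) t := by
    have := (((hasDerivAt_id t).sub_const 0).pow 2).neg.div_const (2 * ((1 : ℝ≥0) : ℝ))
    refine this.congr_deriv ?_
    simp
    ring
  have := h.exp.const_mul (√(2 * Real.pi * ((1 : ℝ≥0) : ℝ)))⁻¹
  refine this.congr_deriv ?_
  rw [gaussianPDFReal_def]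
  ring

lemma integrable_mul_of_bounded {Ω : Type*} [MeasurableSpace Ω] {μ : Measure Ω} {f g : Ω → ℝ}
    (hf : Integrable f μ) (hg : AEStronglyMeasurable g μ) {A : ℝ} (hA : ∀ x, |g x| ≤ A) :
    Integrable (fun x => f x * g x) μ :=
  hf.mul_bdd (c := A) hg (ae_of_all _ hA)

/-- Integration by parts on the line, since the Gaussian density `w` satisfies `w'(t) = -t w(t)`. -/
lemma integral_id_mul_gaussianReal {φ φ' : ℝ → ℝ} (hφ : ∀ t, HasDerivAt φ (φ' t) t)
    (hc : Continuous φ') {A B : ℝ} (hA : ∀ t, |φ t| ≤ A) (hB : ∀ t, |φ' t| ≤ B) :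
    ∫ t, t * φ t ∂gaussianReal 0 1 = ∫ t, φ' t ∂gaussianReal 0 1 := by
  have hcφ : Continuous φ := continuous_iff_continuousAt.2 fun t => (hφ t).continuousAt
  have hid : Integrable (fun t : ℝ => t) (gaussianReal 0 1) :=
    memLp_one_iff_integrable.1 (memLp_id_gaussianReal' 1 (by simp))
  have h1 : Integrable (fun t => t * φ t) (gaussianReal 0 1) :=
    integrable_mul_of_bounded hid hcφ.aestronglyMeasurable hA
  have h2 : Integrable φ' (gaussianReal 0 1) :=
    Integrable.of_bound hc.aestronglyMeasurable B (ae_of_all _ hB)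
  have h3 : Integrable φ (gaussianReal 0 1) :=
    Integrable.of_bound hcφ.aestronglyMeasurable A (ae_of_all _ hA)
  rw [integrable_gaussianReal_iff] at h1 h2 h3
  rw [integral_gaussianReal_eq_integral_smul one_ne_zero,
    integral_gaussianReal_eq_integral_smul one_ne_zero]
  have h1' : Integrable ((fun t => -t * gaussianPDFReal 0 1 t) * φ) := by
    refine h1.neg.congr (ae_of_all _ fun t => ?_)
    simp only [Pi.neg_apply, Pi.mul_apply]
    ring
  have := integral_mul_deriv_eq_deriv_mul_of_integrable
    (fun x _ => hasDerivAt_gaussianPDFReal x) (fun x _ => hφ x) h2 h1' h3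
  simp only [smul_eq_mul]
  rw [this, ← integral_neg]
  congr 1
  ext t
  ring

lemma toLp_insertNth {m : ℕ} (a : Fin (m + 1)) (t : ℝ) (y : Fin m → ℝ) :
    WithLp.toLp 2 (a.insertNth t y : Fin (m + 1) → ℝ) =
      WithLp.toLp 2 (a.insertNth 0 y : Fin (m + 1) → ℝ) + t • EuclideanSpace.single a (1 : ℝ) := by
  ext i
  refine Fin.succAboveCases a ?_ (fun j => ?_) i <;> simp

lemma memLp_id_stdGaussMeasure (n : ℕ) : MemLp (fun x : 𝔼 n => x) 2 (stdGaussMeasure n) :=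
  IsGaussian.memLp_two_id

lemma integrable_norm_stdGaussMeasure (n : ℕ) :
    Integrable (fun x : 𝔼 n => ‖x‖) (stdGaussMeasure n) :=
  ((memLp_id_stdGaussMeasure n).integrable (by norm_num)).norm

lemma integrable_coord_stdGaussMeasure {n : ℕ} (a : Fin n) :
    Integrable (fun x : 𝔼 n => x a) (stdGaussMeasure n) :=
  (integrable_norm_stdGaussMeasure n).mono' (by fun_prop)
    (ae_of_all _ fun x => PiLp.norm_apply_le x a)

/-- Fubini with the coordinate `a` integrated innermost, which reduces integration by parts in
direction `a` to dimension one. -/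
lemma integral_stdGaussMeasure_succ {m : ℕ} (a : Fin (m + 1)) {F : (𝔼 (m + 1)) → ℝ}
    (hF : Integrable F (stdGaussMeasure (m + 1))) :
    ∫ x, F x ∂stdGaussMeasure (m + 1) = ∫ y : Fin m → ℝ, ∫ t,
      F (WithLp.toLp 2 (a.insertNth t y : Fin (m + 1) → ℝ)) ∂gaussianReal 0 1
        ∂(Measure.pi fun _ => gaussianReal 0 1) := by
  have hmp : MeasurePreserving (WithLp.toLp 2 : (Fin (m + 1) → ℝ) → 𝔼 (m + 1))
      (Measure.pi fun _ => gaussianReal 0 1) (stdGaussMeasure (m + 1)) :=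
    ⟨by fun_prop, map_pi_eq_stdGaussian⟩
  have hmp2 := hmp.comp
    ((measurePreserving_piFinSuccAbove (fun _ : Fin (m + 1) => gaussianReal 0 1) a).symm)
  have hi := hmp2.integrable_comp_of_integrable hF
  rw [← hmp2.map_eq, integral_map hmp2.measurable.aemeasurable
    (by rw [hmp2.map_eq]; exact hF.aestronglyMeasurable)]
  exact integral_prod_symm _ hi

/-- **Gaussian integration by parts** for bounded `C¹` functions with bounded gradient. -/
theorem integral_coord_mul_stdGaussMeasure {n : ℕ} (a : Fin n) {φ : (𝔼 n) → ℝ}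
    (hφ : ContDiff ℝ 1 φ) {A B : ℝ} (hA : ∀ x, |φ x| ≤ A)
    (hB : ∀ x, |fderiv ℝ φ x (EuclideanSpace.single a 1)| ≤ B) :
    ∫ x, x a * φ x ∂stdGaussMeasure n =
      ∫ x, fderiv ℝ φ x (EuclideanSpace.single a 1) ∂stdGaussMeasure n := by
  obtain _ | m := n
  · exact a.elim0
  have hc' : Continuous fun x => fderiv ℝ φ x (EuclideanSpace.single a 1) :=
    (hφ.continuous_fderiv one_ne_zero).clm_apply continuous_const
  rw [integral_stdGaussMeasure_succ a, integral_stdGaussMeasure_succ a]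
  · congr 1
    ext y
    have hd : ∀ t : ℝ, HasDerivAt
        (fun t : ℝ => WithLp.toLp 2 (a.insertNth t y : Fin (m + 1) → ℝ))
        (EuclideanSpace.single a (1 : ℝ)) t := by
      intro t
      rw [funext fun t => toLp_insertNth a t y]
      simpa using ((hasDerivAt_id t).smul_const (EuclideanSpace.single a (1 : ℝ))).const_add
        (WithLp.toLp 2 (a.insertNth 0 y : Fin (m + 1) → ℝ))
    have hcy : Continuous fun t : ℝ => WithLp.toLp 2 (a.insertNth t y : Fin (m + 1) → ℝ) :=
      continuous_iff_continuousAt.2 fun t => (hd t).continuousAt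
    have := integral_id_mul_gaussianReal
      (φ := fun t => φ (WithLp.toLp 2 (a.insertNth t y : Fin (m + 1) → ℝ)))
      (fun t => ((hφ.differentiable one_ne_zero _).hasFDerivAt.comp_hasDerivAt t (hd t)))
      (hc'.comp hcy) (fun t => hA _) (fun t => hB _)
    simpa using this
  · exact Integrable.of_bound hc'.aestronglyMeasurable B (ae_of_all _ hB)
  · exact integrable_mul_of_bounded (integrable_coord_stdGaussMeasure a)
      hφ.continuous.aestronglyMeasurable hA

end GaussianIntegrationByParts

/-! ### The derivative of the Gaussian covariance in the angle. -/

section GaussCov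

/-- `E[h(X) h(Y)]` for standard Gaussian vectors `X`, `Y` with correlation `cos θ`. -/
noncomputable def gaussCov {n : ℕ} (h : (𝔼 n) → ℝ) (θ : ℝ) : ℝ :=
  ∫ z, h z.1 * h (Real.cos θ • z.1 + Real.sin θ • z.2)
    ∂((stdGaussMeasure n).prod (stdGaussMeasure n))

lemma fderiv_apply_eq_sum {n : ℕ} (h : (𝔼 n) → ℝ) (x w : 𝔼 n) :
    fderiv ℝ h x w = ∑ a, w a * fderiv ℝ h x (EuclideanSpace.single a 1) := by
  conv_lhs => rw [← (EuclideanSpace.basisFun (Fin n) ℝ).sum_repr w, map_sum]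
  simp

/-- Differentiation under the integral sign; the integrand's derivative is dominated by `A B (‖x‖ +
‖z‖)`, which is integrable. -/
lemma hasDerivAt_gaussCov_aux {n : ℕ} {h : (𝔼 n) → ℝ} (hh : ContDiff ℝ 1 h) {A B : ℝ}
    (hA : ∀ x, |h x| ≤ A) (hB : ∀ x, ‖fderiv ℝ h x‖ ≤ B) (θ : ℝ) :
    HasDerivAt (gaussCov h) (∫ z, h z.1 * fderiv ℝ h (Real.cos θ • z.1 + Real.sin θ • z.2)
      (-Real.sin θ • z.1 + Real.cos θ • z.2) ∂((stdGaussMeasure n).prod (stdGaussMeasure n))) θ := by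
  have hA0 : 0 ≤ A := (abs_nonneg _).trans (hA 0)
  have hB0 : 0 ≤ B := (norm_nonneg _).trans (hB 0)
  have hcont := hh.continuous
  have hcont' := hh.continuous_fderiv one_ne_zero
  refine (hasDerivAt_integral_of_dominated_loc_of_deriv_le (s := Set.univ)
    (F' := fun θ (z : (𝔼 n) × (𝔼 n)) => h z.1 * fderiv ℝ h (Real.cos θ • z.1 + Real.sin θ • z.2)
      (-Real.sin θ • z.1 + Real.cos θ • z.2))
    (bound := fun z : (𝔼 n) × (𝔼 n) => A * (B * (‖z.1‖ + ‖z.2‖))) univ_mem (Eventually.of_forall fun θ' => ?_) ?_ ?_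
    (ae_of_all _ fun z θ' _ => ?_) ?_ (ae_of_all _ fun z θ' _ => ?_)).2
  · exact Continuous.aestronglyMeasurable (by fun_prop)
  · refine Integrable.of_bound (Continuous.aestronglyMeasurable (by fun_prop)) (A * A)
      (ae_of_all _ fun z => ?_)
    rw [norm_mul]
    exact mul_le_mul (hA _) (hA _) (norm_nonneg _) hA0
  · exact Continuous.aestronglyMeasurable
      (Continuous.mul (by fun_prop) (Continuous.clm_apply (by fun_prop) (by fun_prop)))
  · rw [norm_mul]
    refine mul_le_mul (hA _) ?_ (norm_nonneg _) hA0
    refine (ContinuousLinearMap.le_of_opNorm_le _ (hB _) _).trans ?_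
    refine mul_le_mul_of_nonneg_left ((norm_add_le _ _).trans (add_le_add ?_ ?_)) hB0
    · rw [norm_smul, norm_neg]
      exact mul_le_of_le_one_left (norm_nonneg _) (Real.abs_sin_le_one _)
    · rw [norm_smul]
      exact mul_le_of_le_one_left (norm_nonneg _) (Real.abs_cos_le_one _)
  · refine Integrable.const_mul (Integrable.const_mul (Integrable.add ?_ ?_) _) _
    · exact measurePreserving_fst.integrable_comp_of_integrable (integrable_norm_stdGaussMeasure n)
    · exact measurePreserving_snd.integrable_comp_of_integrable (integrable_norm_stdGaussMeasure n)
  · have hy : HasDerivAt (fun θ : ℝ => Real.cos θ • z.1 + Real.sin θ • z.2)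
        (-Real.sin θ' • z.1 + Real.cos θ' • z.2) θ' :=
      ((Real.hasDerivAt_cos θ').smul_const z.1).add ((Real.hasDerivAt_sin θ').smul_const z.2)
    exact ((hh.differentiable one_ne_zero _).hasFDerivAt.comp_hasDerivAt θ' hy).const_mul (h z.1)

/-- With `U = cX + sZ` and `V = -sX + cZ`, again independent standard Gaussians, `X = cU - sV` and
the derivative is `E[h(cU - sV) ⟨V, ∇h(U)⟩]`. For fixed `U`, integration by parts in `V` replaces
the factor `V_a` by the derivative of `h(cU - sV)`, whence the factor `-s`; rotating back identifies
the covariances of the `∂_a h`. -/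
lemma hasDerivAt_gaussCov {n : ℕ} {h : (𝔼 n) → ℝ} (hh : ContDiff ℝ 1 h) {A B : ℝ}
    (hA : ∀ x, |h x| ≤ A) (hB : ∀ x, ‖fderiv ℝ h x‖ ≤ B) (θ : ℝ) :
    HasDerivAt (gaussCov h) (-Real.sin θ *
      ∑ a, gaussCov (fun x => fderiv ℝ h x (EuclideanSpace.single a 1)) θ) θ := by
  have hA0 : 0 ≤ A := (abs_nonneg _).trans (hA 0)
  have hB0 : 0 ≤ B := (norm_nonneg _).trans (hB 0)
  have hcont := hh.continuous
  have hcont' := hh.continuous_fderiv one_ne_zero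
  refine (hasDerivAt_gaussCov_aux hh hA hB θ).congr_deriv ?_
  set c := Real.cos θ with hc
  set s := Real.sin θ with hs
  set μ := (stdGaussMeasure n).prod (stdGaussMeasure n) with hμ
  have hback : ∀ x z : 𝔼 n, c • (c • x + s • z) - s • (-s • x + c • z) = x := by
    intro x z
    have hcs : c * c + s * s = 1 := by
      have := Real.sin_sq_add_cos_sq θ; rw [← hc, ← hs] at this; nlinarith
    calc c • (c • x + s • z) - s • (-s • x + c • z) = (c * c + s * s) • x := by module
      _ = x := by rw [hcs, one_smul]
  have hrot : MeasurePreserving (ContinuousLinearMap.rotation θ) μ μ :=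
    measurePreserving_rotation n θ
  have hpd : ∀ a, Continuous fun x => fderiv ℝ h x (EuclideanSpace.single a 1) := fun a =>
    hcont'.clm_apply continuous_const
  have hpB : ∀ a x, |fderiv ℝ h x (EuclideanSpace.single a 1)| ≤ B := fun a x => by
    simpa using ContinuousLinearMap.le_of_opNorm_le _ (hB x) (EuclideanSpace.single a (1 : ℝ))
  have step : ∀ Ψ : (𝔼 n) × (𝔼 n) → ℝ, Continuous Ψ →
      ∫ z, Ψ (c • z.1 + s • z.2, -s • z.1 + c • z.2) ∂μ = ∫ z, Ψ z ∂μ := by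
    intro Ψ hΨ
    have h := integral_map hrot.measurable.aemeasurable
      (hΨ.aestronglyMeasurable (μ := μ.map (ContinuousLinearMap.rotation θ)))
    rw [hrot.map_eq] at h
    exact h.symm
  have hint : ∀ a, Integrable (fun z : (𝔼 n) × (𝔼 n) => z.2 a * (h (c • z.1 - s • z.2) *
      fderiv ℝ h z.1 (EuclideanSpace.single a 1))) μ := by
    intro a
    refine integrable_mul_of_bounded (A := A * B)
      (measurePreserving_snd.integrable_comp_of_integrable (integrable_coord_stdGaussMeasure a))
      ?_ fun z => ?_
    · have := hpd a
      exact Continuous.aestronglyMeasurable (by fun_prop)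
    · rw [abs_mul]; exact mul_le_mul (hA _) (hpB _ _) (abs_nonneg _) hA0
  have hint2 : ∀ a, Integrable (fun z : (𝔼 n) × (𝔼 n) =>
      fderiv ℝ h (c • z.1 - s • z.2) (EuclideanSpace.single a 1) *
      fderiv ℝ h z.1 (EuclideanSpace.single a 1)) μ := by
    intro a
    have := hpd a
    refine Integrable.of_bound (Continuous.aestronglyMeasurable (by fun_prop)) (B * B)
      (ae_of_all _ fun z => ?_)
    rw [norm_mul]; exact mul_le_mul (hpB _ _) (hpB _ _) (abs_nonneg _) hB0
  have e1 : ∫ z, h z.1 * fderiv ℝ h (c • z.1 + s • z.2) (-s • z.1 + c • z.2) ∂μ =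
      ∫ z : (𝔼 n) × (𝔼 n), h (c • z.1 - s • z.2) * fderiv ℝ h z.1 z.2 ∂μ := by
    rw [← step (fun z => h (c • z.1 - s • z.2) * fderiv ℝ h z.1 z.2)
      (Continuous.mul (by fun_prop) (Continuous.clm_apply (by fun_prop) (by fun_prop)))]
    simp only [hback]
  have e2 : ∀ a, gaussCov (fun x => fderiv ℝ h x (EuclideanSpace.single a 1)) θ =
      ∫ z : (𝔼 n) × (𝔼 n), fderiv ℝ h (c • z.1 - s • z.2) (EuclideanSpace.single a 1) *
        fderiv ℝ h z.1 (EuclideanSpace.single a 1) ∂μ := by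
    intro a
    have := hpd a
    rw [← step _ (by fun_prop)]
    simp only [hback]
    rfl
  have e3 : ∀ z : (𝔼 n) × (𝔼 n), h (c • z.1 - s • z.2) * fderiv ℝ h z.1 z.2 =
      ∑ a, z.2 a * (h (c • z.1 - s • z.2) * fderiv ℝ h z.1 (EuclideanSpace.single a 1)) := by
    intro z
    rw [fderiv_apply_eq_sum, Finset.mul_sum]
    exact Finset.sum_congr rfl fun a _ => by ring
  rw [e1, Finset.mul_sum, integral_congr_ae (ae_of_all _ e3)]
  rw [integral_finsetSum _ fun a _ => hint a]
  refine Finset.sum_congr rfl fun a _ => ?_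
  -- For fixed first variable, `∂_a h` at that point is a constant factor, so only the integral in
  -- the second variable has to be integrated by parts.
  rw [e2, hμ, integral_prod _ (hint a), integral_prod _ (hint2 a), ← integral_const_mul]
  congr 1
  ext y
  simp only [← mul_assoc]
  rw [integral_mul_const, integral_mul_const, ← mul_assoc]
  congr 1
  have hfd : ∀ w : 𝔼 n, HasFDerivAt (fun w : 𝔼 n => h (c • y - s • w))
      ((fderiv ℝ h (c • y - s • w)).comp (-(s • ContinuousLinearMap.id ℝ (𝔼 n)))) w := fun w =>
    (hh.differentiable one_ne_zero _).hasFDerivAt.comp w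
      (((hasFDerivAt_id w).const_smul s).const_sub (c • y))
  have hval : ∀ w : 𝔼 n, fderiv ℝ (fun w : 𝔼 n => h (c • y - s • w)) w
      (EuclideanSpace.single a 1) =
      -s * fderiv ℝ h (c • y - s • w) (EuclideanSpace.single a 1) := fun w => by
    rw [(hfd w).fderiv]
    simp
  rw [integral_coord_mul_stdGaussMeasure a (φ := fun w => h (c • y - s • w)) (by fun_prop)
    (fun w => hA _) (B := |s| * B) (fun w => ?_)]
  · simp_rw [hval]
    rw [integral_const_mul]
  · rw [hval, abs_mul, abs_neg]
    exact mul_le_mul_of_nonneg_left (hpB _ _) (abs_nonneg _)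

end GaussCov

/-! ### Extension to square-integrable functions and reparametrization by the correlation. -/

section GaussCovL2

lemma integrable_mul_correlated {n : ℕ} {f g : (𝔼 n) → ℝ} (hf : MemLp f 2 (stdGaussMeasure n))
    (hg : MemLp g 2 (stdGaussMeasure n)) (θ : ℝ) :
    Integrable (fun z : (𝔼 n) × (𝔼 n) => f z.1 * g (Real.cos θ • z.1 + Real.sin θ • z.2))
      ((stdGaussMeasure n).prod (stdGaussMeasure n)) :=
  (hf.comp_measurePreserving measurePreserving_fst).integrable_mul
    (hg.comp_measurePreserving (measurePreserving_correlated n θ))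

/-- Weighted Cauchy–Schwarz inequality for a pair of correlated Gaussian vectors. -/
lemma integral_mul_correlated_le {n : ℕ} {f g : (𝔼 n) → ℝ} (hf : MemLp f 2 (stdGaussMeasure n))
    (hg : MemLp g 2 (stdGaussMeasure n)) (θ : ℝ) {t : ℝ} (ht : 0 < t) :
    |∫ z, f z.1 * g (Real.cos θ • z.1 + Real.sin θ • z.2)
        ∂((stdGaussMeasure n).prod (stdGaussMeasure n))| ≤
      (t * ∫ x, f x ^ 2 ∂stdGaussMeasure n) + t⁻¹ * ∫ x, g x ^ 2 ∂stdGaussMeasure n := by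
  have h1 := measurePreserving_fst (μ := stdGaussMeasure n) (ν := stdGaussMeasure n)
  have h2 := measurePreserving_correlated n θ
  have i1 : Integrable (fun z : (𝔼 n) × (𝔼 n) => f z.1 ^ 2)
      ((stdGaussMeasure n).prod (stdGaussMeasure n)) :=
    (hf.comp_measurePreserving h1).integrable_sq
  have i2 : Integrable (fun z : (𝔼 n) × (𝔼 n) =>
      g (Real.cos θ • z.1 + Real.sin θ • z.2) ^ 2)
      ((stdGaussMeasure n).prod (stdGaussMeasure n)) :=
    (hg.comp_measurePreserving h2).integrable_sq
  have e1 : ∫ z, f z.1 ^ 2 ∂((stdGaussMeasure n).prod (stdGaussMeasure n)) =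
      ∫ x, f x ^ 2 ∂stdGaussMeasure n := by
    have := integral_map h1.measurable.aemeasurable (f := fun x => f x ^ 2)
      (by rw [h1.map_eq]; exact hf.integrable_sq.aestronglyMeasurable)
    rw [h1.map_eq] at this
    exact this.symm
  have e2 : ∫ z, g (Real.cos θ • z.1 + Real.sin θ • z.2) ^ 2
      ∂((stdGaussMeasure n).prod (stdGaussMeasure n)) = ∫ x, g x ^ 2 ∂stdGaussMeasure n := by
    have := integral_map h2.measurable.aemeasurable (f := fun x => g x ^ 2)
      (by rw [h2.map_eq]; exact hg.integrable_sq.aestronglyMeasurable)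
    rw [h2.map_eq] at this
    exact this.symm
  rw [← e1, ← e2, ← integral_const_mul, ← integral_const_mul,
    ← integral_add (i1.const_mul t) (i2.const_mul t⁻¹)]
  refine abs_integral_le_integral_abs.trans (integral_mono
    (integrable_mul_correlated hf hg θ).abs ((i1.const_mul t).add (i2.const_mul t⁻¹)) fun z => ?_)
  set u := f z.1
  set v := g (Real.cos θ • z.1 + Real.sin θ • z.2)
  have : t * u ^ 2 + t⁻¹ * v ^ 2 - 2 * (|u| * |v|) = t⁻¹ * (t * |u| - |v|) ^ 2 := by
    rw [← sq_abs u, ← sq_abs v]; field_simp; ring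
  rw [abs_mul]
  nlinarith [mul_nonneg (inv_pos.2 ht).le (sq_nonneg (t * |u| - |v|)), abs_nonneg u, abs_nonneg v,
    mul_nonneg (abs_nonneg u) (abs_nonneg v)]

lemma abs_gaussCov_le {n : ℕ} {f : (𝔼 n) → ℝ} (hf : MemLp f 2 (stdGaussMeasure n)) (θ : ℝ) :
    |gaussCov f θ| ≤ 2 * ∫ x, f x ^ 2 ∂stdGaussMeasure n := by
  refine (integral_mul_correlated_le hf hf θ one_pos).trans (le_of_eq ?_)
  ring

lemma continuous_gaussCov_of_bounded {n : ℕ} {f : (𝔼 n) → ℝ} (hf : Continuous f) {A : ℝ}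
    (hA : ∀ x, |f x| ≤ A) : Continuous (gaussCov f) := by
  have hA0 : 0 ≤ A := (abs_nonneg _).trans (hA 0)
  refine continuous_of_dominated (bound := fun _ => A * A) (fun θ => ?_) (fun θ => ?_)
    (integrable_const _) ?_
  · exact Continuous.aestronglyMeasurable (by fun_prop)
  · refine ae_of_all _ fun z => ?_
    rw [norm_mul]
    exact mul_le_mul (hA _) (hA _) (norm_nonneg _) hA0
  · exact ae_of_all _ fun z => by fun_prop

lemma abs_truncation_le (y : ℝ) (M : ℕ) : |max (-(M : ℝ)) (min y M)| ≤ M := by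
  have hM : (0 : ℝ) ≤ M := Nat.cast_nonneg M
  rw [abs_le]
  exact ⟨le_max_left _ _, max_le (by linarith) (min_le_right _ _)⟩

lemma abs_truncation_le_abs (y : ℝ) (M : ℕ) : |max (-(M : ℝ)) (min y M)| ≤ |y| := by
  have hM : (0 : ℝ) ≤ M := Nat.cast_nonneg M
  rw [abs_le]
  refine ⟨?_, max_le ((neg_nonpos.2 hM).trans (abs_nonneg y)) ((min_le_left _ _).trans
    (le_abs_self y))⟩
  rcases le_total y M with h | h
  · rw [min_eq_left h]; exact (neg_abs_le y).trans (le_max_right _ _)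
  · rw [min_eq_right h]; exact (neg_nonpos.2 (abs_nonneg y)).trans (hM.trans (le_max_right _ _))

lemma abs_sub_truncation_le_abs (y : ℝ) (M : ℕ) : |y - max (-(M : ℝ)) (min y M)| ≤ |y| := by
  have hM : (0 : ℝ) ≤ M := Nat.cast_nonneg M
  rw [abs_le]
  rcases le_total y M with h | h <;> rcases le_total (-(M : ℝ)) (min y M) with h' | h' <;>
    simp only [h', max_eq_left, max_eq_right] <;> simp only [h, min_eq_left, min_eq_right] at h' ⊢ <;>
    constructor <;> linarith [neg_abs_le y, le_abs_self y, abs_nonneg y]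

lemma tendsto_integral_sq_sub_truncation {n : ℕ} {f : (𝔼 n) → ℝ} (hf : Continuous f)
    (hL : MemLp f 2 (stdGaussMeasure n)) :
    Tendsto (fun M : ℕ => ∫ x, (f x - max (-(M : ℝ)) (min (f x) M)) ^ 2 ∂stdGaussMeasure n) atTop
      (𝓝 0) := by
  rw [← integral_zero (𝔼 n) ℝ (μ := stdGaussMeasure n)]
  refine tendsto_integral_of_dominated_convergence (fun x => f x ^ 2)
    (fun M => Continuous.aestronglyMeasurable (by fun_prop)) hL.integrable_sq
    (fun M => ae_of_all _ fun x => ?_) (ae_of_all _ fun x => ?_)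
  · rw [Real.norm_eq_abs, abs_of_nonneg (sq_nonneg _)]
    exact sq_le_sq.2 (abs_sub_truncation_le_abs _ _)
  · refine tendsto_const_nhds.congr' ?_
    filter_upwards [eventually_ge_atTop ⌈|f x|⌉₊] with M hM
    have : |f x| ≤ M := (Nat.le_ceil _).trans (by exact_mod_cast hM)
    rw [abs_le] at this
    rw [min_eq_left this.2, max_eq_right this.1]
    simp

/-- The covariance depends on the function continuously in `L²`, uniformly in `θ`. Truncations
converge in `L²` and have continuous covariances, so `gaussCov f` is a uniform limit of continuous
functions. -/
lemma continuous_gaussCov {n : ℕ} {f : (𝔼 n) → ℝ} (hf : Continuous f)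
    (hL : MemLp f 2 (stdGaussMeasure n)) : Continuous (gaussCov f) := by
  set S := ∫ x, f x ^ 2 ∂stdGaussMeasure n with hS
  have hS0 : 0 ≤ S := integral_nonneg fun x => sq_nonneg _
  let g : ℕ → (𝔼 n) → ℝ := fun M x => max (-(M : ℝ)) (min (f x) M)
  have hgc : ∀ M, Continuous (g M) := fun M => by fun_prop
  have hgL : ∀ M, MemLp (g M) 2 (stdGaussMeasure n) := fun M =>
    hL.mono (hgc M).aestronglyMeasurable (ae_of_all _ fun x => abs_truncation_le_abs _ _)
  have hgS : ∀ M, ∫ x, g M x ^ 2 ∂stdGaussMeasure n ≤ S := fun M =>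
    integral_mono (hgL M).integrable_sq hL.integrable_sq fun x =>
      sq_le_sq.2 (abs_truncation_le_abs _ _)
  have hd : ∀ M θ {t : ℝ}, 0 < t → |gaussCov f θ - gaussCov (g M) θ| ≤
      2 * (t * ∫ x, (f x - g M x) ^ 2 ∂stdGaussMeasure n) + 2 * (t⁻¹ * S) := by
    intro M θ t ht
    have hfg := hL.sub (hgL M)
    have e : gaussCov f θ - gaussCov (g M) θ =
        (∫ z, (f - g M) z.1 * f (Real.cos θ • z.1 + Real.sin θ • z.2)
          ∂((stdGaussMeasure n).prod (stdGaussMeasure n))) +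
        ∫ z, g M z.1 * (f - g M) (Real.cos θ • z.1 + Real.sin θ • z.2)
          ∂((stdGaussMeasure n).prod (stdGaussMeasure n)) := by
      rw [gaussCov, gaussCov, ← integral_sub (integrable_mul_correlated hL hL θ)
        (integrable_mul_correlated (hgL M) (hgL M) θ),
        ← integral_add (integrable_mul_correlated hfg hL θ)
        (integrable_mul_correlated (hgL M) hfg θ)]
      congr 1
      ext z
      simp only [Pi.sub_apply]
      ring
    rw [e]
    have b1 := integral_mul_correlated_le hfg hL θ ht
    have b2 := integral_mul_correlated_le (hgL M) hfg θ (inv_pos.2 ht)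
    rw [inv_inv] at b2
    have b3 := mul_le_mul_of_nonneg_left (hgS M) (inv_pos.2 ht).le
    refine (abs_add_le _ _).trans ?_
    simp only [Pi.sub_apply] at b1 b2 ⊢
    linarith
  have hunif : TendstoUniformly (fun M : ℕ => gaussCov (g M)) (gaussCov f) atTop := by
    rw [Metric.tendstoUniformly_iff]
    intro ε hε
    -- This `t` makes `2 t⁻¹ S ≤ ε/2`; once the truncation error is below `ε/(4t)`, the other term
    -- is below `ε/2`. Using `S + 1` keeps `t` positive when `S = 0`.
    set t := 4 * (S + 1) / ε with ht
    have ht0 : 0 < t := by positivity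
    have hlim := tendsto_integral_sq_sub_truncation hf hL
    filter_upwards [hlim.eventually_lt_const (u := ε / (4 * t)) (by positivity)] with M hM θ
    rw [Real.dist_eq]
    refine (hd M θ ht0).trans_lt ?_
    have h1 : t * ∫ x, (f x - g M x) ^ 2 ∂stdGaussMeasure n < t * (ε / (4 * t)) :=
      mul_lt_mul_of_pos_left hM ht0
    have h2 : t * (ε / (4 * t)) = ε / 4 := by field_simp
    have h3 : t⁻¹ * S ≤ ε / 4 := by
      rw [ht, inv_div, div_mul_eq_mul_div, div_le_div_iff₀ (by positivity) (by positivity)]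
      nlinarith
    linarith
  exact hunif.continuous (Frequently.of_forall fun M =>
    continuous_gaussCov_of_bounded (hgc M) (A := M) fun x => abs_truncation_le _ _)

lemma tendsto_gaussCov {n : ℕ} {f : ℕ → (𝔼 n) → ℝ} {g G : (𝔼 n) → ℝ}
    (hf : ∀ m, Continuous (f m)) (hG : MemLp G 2 (stdGaussMeasure n))
    (hb : ∀ m x, |f m x| ≤ G x) (hlim : ∀ x, Tendsto (fun m => f m x) atTop (𝓝 (g x))) (θ : ℝ) :
    Tendsto (fun m => gaussCov (f m) θ) atTop (𝓝 (gaussCov g θ)) := by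
  refine tendsto_integral_of_dominated_convergence _ (fun m => ?_)
    (integrable_mul_correlated hG hG θ) (fun m => ae_of_all _ fun z => ?_)
    (ae_of_all _ fun z => (hlim _).mul (hlim _))
  · have := hf m
    exact Continuous.aestronglyMeasurable (by fun_prop)
  · rw [norm_mul]
    exact mul_le_mul (hb m _) (hb m _) (norm_nonneg _) ((abs_nonneg _).trans (hb m _))

/-- `E[h(X) h(Y)]` for standard Gaussian vectors `X`, `Y` with correlation `r ∈ [0, 1]`. -/
noncomputable def gaussCorr {n : ℕ} (h : (𝔼 n) → ℝ) (r : ℝ) : ℝ := gaussCov h (Real.arccos r)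

lemma continuous_gaussCorr {n : ℕ} {f : (𝔼 n) → ℝ} (hf : Continuous f)
    (hL : MemLp f 2 (stdGaussMeasure n)) : Continuous (gaussCorr f) :=
  (continuous_gaussCov hf hL).comp Real.continuous_arccos

lemma gaussCorr_one {n : ℕ} {f : (𝔼 n) → ℝ} (hL : MemLp f 2 (stdGaussMeasure n)) :
    gaussCorr f 1 = ∫ x, f x ^ 2 ∂stdGaussMeasure n := by
  have hmp := measurePreserving_fst (μ := stdGaussMeasure n) (ν := stdGaussMeasure n)
  have h := integral_map hmp.measurable.aemeasurable (f := fun x => f x ^ 2)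
    (by rw [hmp.map_eq]; exact hL.integrable_sq.aestronglyMeasurable)
  rw [hmp.map_eq] at h
  rw [h, gaussCorr, gaussCov]
  simp [sq]

lemma gaussCorr_zero {n : ℕ} (f : (𝔼 n) → ℝ) :
    gaussCorr f 0 = (∫ x, f x ∂stdGaussMeasure n) ^ 2 := by
  rw [gaussCorr, gaussCov]
  simp only [Real.arccos_zero, Real.cos_pi_div_two, Real.sin_pi_div_two, zero_smul, one_smul,
    zero_add]
  rw [integral_prod_mul f f, sq]

/-- In the variable `r = cos θ` the factor `-sin θ` cancels the derivative `-1/√(1-r²)` of `arccos`.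
This fails at `r = 1`, so differentiability is used on the open interval only, with continuity at
the endpoints. -/
lemma gaussCorr_sub_of_bounded {n : ℕ} {h : (𝔼 n) → ℝ} (hh : ContDiff ℝ 1 h) {A B : ℝ}
    (hA : ∀ x, |h x| ≤ A) (hB : ∀ x, ‖fderiv ℝ h x‖ ≤ B) {b : ℝ} (hb0 : 0 ≤ b) (hb1 : b ≤ 1) :
    ∫ r in (0 : ℝ)..b, ∑ a, gaussCorr (fun x => fderiv ℝ h x (EuclideanSpace.single a 1)) r =
      gaussCorr h b - gaussCorr h 0 := by
  have hpc : ∀ a, Continuous fun x => fderiv ℝ h x (EuclideanSpace.single a 1) := fun a =>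
    (hh.continuous_fderiv one_ne_zero).clm_apply continuous_const
  have hpB : ∀ a x, |fderiv ℝ h x (EuclideanSpace.single a 1)| ≤ B := fun a x => by
    simpa using ContinuousLinearMap.le_of_opNorm_le _ (hB x) (EuclideanSpace.single a (1 : ℝ))
  have hc : ∀ a, Continuous (gaussCorr fun x => fderiv ℝ h x (EuclideanSpace.single a 1)) :=
    fun a => (continuous_gaussCov_of_bounded (hpc a) (hpB a)).comp Real.continuous_arccos
  refine intervalIntegral.integral_eq_sub_of_hasDerivAt_of_le hb0
    ((continuous_gaussCov_of_bounded hh.continuous hA).comp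
      Real.continuous_arccos).continuousOn (fun r hr => ?_)
    (Continuous.intervalIntegrable (by fun_prop) _ _)
  have h1 := Real.hasDerivAt_arccos (x := r) (by linarith [hr.1]) (by linarith [hr.2])
  refine ((hasDerivAt_gaussCov hh hA hB (Real.arccos r)).comp r h1).congr_deriv ?_
  have : √(1 - r ^ 2) ≠ 0 := (Real.sqrt_pos.2 (by nlinarith [hr.1, hr.2])).ne'
  rw [Real.sin_arccos]
  simp only [gaussCorr]
  field_simp

/-- The derivative of `r ↦ E[h(X) h(Y)]`, in integrated form, for `h` in the Gaussian Sobolev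
space. -/
theorem integral_sum_gaussCorr_fderiv {n : ℕ} {h : (𝔼 n) → ℝ} (hh : ContDiff ℝ 1 h)
    (hL : MemLp h 2 (stdGaussMeasure n))
    (hL' : ∀ a, MemLp (fun x => fderiv ℝ h x (EuclideanSpace.single a 1)) 2 (stdGaussMeasure n))
    {b : ℝ} (hb0 : 0 ≤ b) (hb1 : b ≤ 1) :
    ∫ r in (0 : ℝ)..b, ∑ a, gaussCorr (fun x => fderiv ℝ h x (EuclideanSpace.single a 1)) r =
      gaussCorr h b - gaussCorr h 0 := by
  -- Multiplying `h` by the cutoffs `χ(x/(m+1))` gives compactly supported `C¹` functions, to which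
  -- the bounded case applies. Because the scale is at most 1, their partial derivatives are
  -- dominated by `|∂_a h| + K |h|`, uniformly in `m`, and both sides pass to the limit.
  let χ : ContDiffBump (0 : 𝔼 n) := ⟨1, 2, one_pos, one_lt_two⟩
  have hχ : ContDiff ℝ 1 χ := χ.contDiff
  obtain ⟨K, hK⟩ : ∃ K, ∀ x, ‖fderiv ℝ χ x‖ ≤ K :=
    (hχ.continuous_fderiv one_ne_zero).bounded_above_of_compact_support
      (χ.hasCompactSupport.fderiv ℝ)
  let c : ℕ → ℝ := fun m => ((m : ℝ) + 1)⁻¹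
  have hc0 : ∀ m, 0 < c m := fun m => by positivity
  have hc1 : ∀ m, c m ≤ 1 := fun m => inv_le_one_of_one_le₀ (by simp)
  have hclim : Tendsto c atTop (𝓝 0) := by
    simpa [c, one_div] using tendsto_one_div_add_atTop_nhds_zero_nat (𝕜 := ℝ)
  let f : ℕ → (𝔼 n) → ℝ := fun m x => χ (c m • x) * h x
  have hfC : ∀ m, ContDiff ℝ 1 (f m) := fun m => by fun_prop
  have hfs : ∀ m, HasCompactSupport (f m) := fun m =>
    (χ.hasCompactSupport.comp_smul (hc0 m).ne').mul_right
  have hχ1 : ∀ x, |χ x| ≤ 1 := fun x => by rw [abs_of_nonneg χ.nonneg]; exact χ.le_one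
  have hfd : ∀ m x v, fderiv ℝ (f m) x v =
      χ (c m • x) * fderiv ℝ h x v + h x * (c m * fderiv ℝ χ (c m • x) v) := by
    intro m x v
    have h1 : HasFDerivAt (fun x : 𝔼 n => χ (c m • x))
        ((fderiv ℝ χ (c m • x)).comp (c m • ContinuousLinearMap.id ℝ (𝔼 n))) x :=
      (hχ.differentiable one_ne_zero _).hasFDerivAt.comp x ((hasFDerivAt_id x).const_smul (c m))
    have h2 : HasFDerivAt (f m) _ x := h1.mul (hh.differentiable one_ne_zero x).hasFDerivAt
    rw [h2.fderiv]
    simp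
  have hdb : ∀ a m x, |fderiv ℝ (f m) x (EuclideanSpace.single a 1)| ≤
      |fderiv ℝ h x (EuclideanSpace.single a 1)| + K * |h x| := by
    intro a m x
    rw [hfd]
    refine (abs_add_le _ _).trans (add_le_add ?_ ?_)
    · rw [abs_mul]; exact mul_le_of_le_one_left (abs_nonneg _) (hχ1 _)
    · rw [abs_mul, mul_comm K, abs_mul, abs_of_pos (hc0 m)]
      refine mul_le_mul_of_nonneg_left ?_ (abs_nonneg _)
      have := ContinuousLinearMap.le_of_opNorm_le _ (hK (c m • x)) (EuclideanSpace.single a (1 : ℝ))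
      simp only [PiLp.norm_single, norm_one, mul_one, Real.norm_eq_abs] at this
      exact (mul_le_of_le_one_left (abs_nonneg _) (hc1 m)).trans this
  have hχlim : ∀ x : 𝔼 n, Tendsto (fun m => χ (c m • x)) atTop (𝓝 1) := by
    intro x
    have h1 : Tendsto (fun m => c m • x) atTop (𝓝 0) := by
      simpa using hclim.smul_const x
    have h2 := (χ.continuous.tendsto 0).comp h1
    rwa [χ.one_of_mem_closedBall (by simp [χ])] at h2
  have hflim : ∀ x, Tendsto (fun m => f m x) atTop (𝓝 (h x)) := fun x => by
    simpa using (hχlim x).mul_const (h x)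
  have hdlim : ∀ a x, Tendsto (fun m => fderiv ℝ (f m) x (EuclideanSpace.single a 1)) atTop
      (𝓝 (fderiv ℝ h x (EuclideanSpace.single a 1))) := by
    intro a x
    simp_rw [hfd]
    have h1 : Tendsto (fun m => c m * fderiv ℝ χ (c m • x) (EuclideanSpace.single a 1)) atTop
        (𝓝 0) := by
      refine squeeze_zero_norm (a := fun m => c m * K) (fun m => ?_) (by simpa using hclim.mul_const K)
      rw [norm_mul, Real.norm_of_nonneg (hc0 m).le]
      refine mul_le_mul_of_nonneg_left ?_ (hc0 m).le
      simpa using ContinuousLinearMap.le_of_opNorm_le _ (hK (c m • x))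
        (EuclideanSpace.single a (1 : ℝ))
    simpa using ((hχlim x).mul_const _).add (h1.const_mul (h x))
  have hfdc : ∀ a m, Continuous fun x => fderiv ℝ (f m) x (EuclideanSpace.single a 1) :=
    fun a m => ((hfC m).continuous_fderiv one_ne_zero).clm_apply continuous_const
  have hGd : ∀ a, MemLp (fun x => |fderiv ℝ h x (EuclideanSpace.single a 1)| + K * |h x|) 2
      (stdGaussMeasure n) := fun a => (hL' a).abs.add (hL.abs.const_mul K)
  have hfdL : ∀ a m, MemLp (fun x => fderiv ℝ (f m) x (EuclideanSpace.single a 1)) 2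
      (stdGaussMeasure n) := fun a m => (hGd a).mono (hfdc a m).aestronglyMeasurable
    (ae_of_all _ fun x => (hdb a m x).trans (le_abs_self _))
  have hcov : ∀ r, Tendsto (fun m => gaussCorr (f m) r) atTop (𝓝 (gaussCorr h r)) := fun r =>
    tendsto_gaussCov (fun m => (hfC m).continuous) hL.abs (fun m x => by
      simp only [f, abs_mul]
      exact mul_le_of_le_one_left (abs_nonneg _) (hχ1 _)) hflim _
  have hRHS := (hcov b).sub (hcov 0)
  have hLHS : Tendsto (fun m => ∫ r in (0 : ℝ)..b, ∑ a,
      gaussCorr (fun x => fderiv ℝ (f m) x (EuclideanSpace.single a 1)) r) atTop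
      (𝓝 (∫ r in (0 : ℝ)..b, ∑ a,
        gaussCorr (fun x => fderiv ℝ h x (EuclideanSpace.single a 1)) r)) := by
    refine intervalIntegral.tendsto_integral_filter_of_dominated_convergence
      (fun _ => ∑ a, 2 * ∫ x, (|fderiv ℝ h x (EuclideanSpace.single a 1)| + K * |h x|) ^ 2
        ∂stdGaussMeasure n) (Eventually.of_forall fun m => ?_)
      (Eventually.of_forall fun m => ae_of_all _ fun r _ => ?_) intervalIntegrable_const
      (ae_of_all _ fun r _ => ?_)
    · exact (continuous_finsetSum _ fun a _ =>
        continuous_gaussCorr (hfdc a m) (hfdL a m)).aestronglyMeasurable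
    · refine (norm_sum_le _ _).trans (Finset.sum_le_sum fun a _ => ?_)
      refine (abs_gaussCov_le (hfdL a m) _).trans (mul_le_mul_of_nonneg_left ?_ zero_le_two)
      refine integral_mono (hfdL a m).integrable_sq (hGd a).integrable_sq fun x => ?_
      exact sq_le_sq.2 ((hdb a m x).trans (le_abs_self _))
    · exact tendsto_finsetSum _ fun a _ =>
        tendsto_gaussCov (fun m => hfdc a m) (hGd a) (hdb a) (hdlim a) _
  refine tendsto_nhds_unique hLHS (hRHS.congr fun m => ?_)
  obtain ⟨A, hA⟩ := (hfC m).continuous.bounded_above_of_compact_support (hfs m)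
  obtain ⟨B, hB⟩ := ((hfC m).continuous_fderiv one_ne_zero).bounded_above_of_compact_support
    ((hfs m).fderiv ℝ)
  exact (gaussCorr_sub_of_bounded (hfC m) hA hB hb0 hb1).symm

end GaussCovL2

/-! ### Bounding the Taylor remainder. -/

section CorrelationBound

/-- Hypercontractivity bounds the correlation by `‖g‖²_{1+r}`, and Hölder interpolates through `1 +
r = (1-r)·1 + r·2`. -/
lemma gaussCorr_le_rpow {n : ℕ} {g : (𝔼 n) → ℝ} (hg : Continuous g)
    (hL : MemLp g 2 (stdGaussMeasure n)) {r : ℝ} (hr0 : 0 < r) (hr1 : r < 1) :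
    gaussCorr g r ≤ (lpNorm g 1 (stdGaussMeasure n) ^ (1 - r) *
      (lpNorm g 2 (stdGaussMeasure n) ^ 2) ^ r) ^ (2 / (1 + r)) := by
  set γ := stdGaussMeasure n
  set A := lpNorm g 1 γ
  set S := lpNorm g 2 γ
  have hA0 : 0 ≤ A := lpNorm_nonneg
  have hS0 : 0 ≤ S := lpNorm_nonneg
  have hL1 : MemLp g 1 γ := hL.mono_exponent one_le_two
  have hcos : Real.cos (Real.arccos r) = r := Real.cos_arccos (by linarith) hr1.le
  have e1 : ∫⁻ x, ‖g x‖ₑ ∂γ = ENNReal.ofReal A := by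
    rw [ofReal_lpNorm hL1, eLpNorm_one_eq_lintegral_enorm]
  have e2 : ∫⁻ x, ‖g x‖ₑ ^ (2 : ℝ) ∂γ = ENNReal.ofReal (S ^ 2) := by
    rw [ENNReal.ofReal_pow lpNorm_nonneg, ofReal_lpNorm hL,
      eLpNorm_eq_lintegral_rpow_enorm_toReal two_ne_zero ENNReal.ofNat_ne_top, ← ENNReal.rpow_two,
      ← ENNReal.rpow_mul]
    simp
  have hyp := lintegral_correlated_le (θ := Real.arccos r) (by rwa [hcos]) (by rwa [hcos])
    (fun x => ‖g x‖₊) hg.nnnorm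
  rw [hcos] at hyp
  have hol : ∫⁻ x, (‖g x‖₊ : ℝ≥0∞) ^ (1 + r) ∂γ ≤
      ENNReal.ofReal A ^ (1 - r) * ENNReal.ofReal (S ^ 2) ^ r := by
    rw [← e1, ← e2]
    refine le_trans (le_of_eq ?_) (ENNReal.lintegral_mul_norm_pow_le (f := fun x => ‖g x‖ₑ)
      (g := fun x => ‖g x‖ₑ ^ (2 : ℝ)) (p := 1 - r) (q := r) (by fun_prop) (by fun_prop)
      (by linarith) hr0.le (by ring))
    congr 1
    ext x
    rw [← ENNReal.rpow_mul, ← ENNReal.rpow_add_of_nonneg _ _ (by linarith) (by linarith)]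
    congr 1
    ring
  rw [← ENNReal.ofReal_le_ofReal_iff (by positivity), ← ENNReal.ofReal_rpow_of_nonneg
    (by positivity) (by positivity), ENNReal.ofReal_mul (by positivity),
    ← ENNReal.ofReal_rpow_of_nonneg lpNorm_nonneg (by linarith),
    ← ENNReal.ofReal_rpow_of_nonneg (by positivity) hr0.le]
  refine le_trans ?_ (hyp.trans (ENNReal.rpow_le_rpow hol (by positivity)))
  rw [gaussCorr, gaussCov, hcos]
  refine (ENNReal.ofReal_le_ofReal (le_abs_self _)).trans ?_
  rw [← Real.enorm_eq_ofReal_abs]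
  refine (enorm_integral_le_lintegral_enorm _).trans (le_of_eq ?_)
  congr 1
  ext z
  exact enorm_mul _ _

lemma lpNorm_one_le_lpNorm_two {n : ℕ} {g : (𝔼 n) → ℝ} (hL : MemLp g 2 (stdGaussMeasure n)) :
    lpNorm g 1 (stdGaussMeasure n) ≤ lpNorm g 2 (stdGaussMeasure n) := by
  rw [← ENNReal.ofReal_le_ofReal_iff lpNorm_nonneg, ofReal_lpNorm hL,
    ofReal_lpNorm (hL.mono_exponent one_le_two)]
  exact eLpNorm_le_eLpNorm_of_exponent_le one_le_two hL.aestronglyMeasurable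

/-- The previous bound equals `S² (A/S)^{2(1-r)/(1+r)}`, where `A` and `S` are the `L¹` and `L²`
norms. Since `A ≤ S` and `2/(1+r) ≥ 1`, the exponent may be lowered to `1-r`. -/
lemma gaussCorr_le_exp {n : ℕ} {g : (𝔼 n) → ℝ} (hg : Continuous g)
    (hL : MemLp g 2 (stdGaussMeasure n)) (hA : 0 < lpNorm g 1 (stdGaussMeasure n)) {r : ℝ}
    (hr0 : 0 < r) (hr1 : r < 1) :
    gaussCorr g r ≤ lpNorm g 2 (stdGaussMeasure n) ^ 2 * Real.exp (-((1 - r) * Real.log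
      (lpNorm g 2 (stdGaussMeasure n) / lpNorm g 1 (stdGaussMeasure n)))) := by
  refine (gaussCorr_le_rpow hg hL hr0 hr1).trans ?_
  have hAS := lpNorm_one_le_lpNorm_two hL
  set A := lpNorm g 1 (stdGaussMeasure n)
  set S := lpNorm g 2 (stdGaussMeasure n)
  have hS : 0 < S := hA.trans_le hAS
  have hl : 0 ≤ Real.log S - Real.log A := sub_nonneg.2 (Real.log_le_log hA hAS)
  rw [Real.log_div hS.ne' hA.ne', ← Real.log_le_log_iff (by positivity) (by positivity),
    Real.log_rpow (by positivity), Real.log_mul (by positivity) (by positivity),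
    Real.log_mul (by positivity) (by positivity), Real.log_rpow hA, Real.log_rpow (by positivity),
    Real.log_pow, Real.log_exp, div_mul_eq_mul_div, div_le_iff₀ (by linarith)]
  push_cast
  -- After taking logarithms and clearing `1+r`, the gap between the two sides is exactly `(1-r)²
  -- log(S/A)`.
  nlinarith [mul_nonneg (mul_nonneg (sub_nonneg.2 hr1.le) hl) (sub_nonneg.2 hr1.le)]

/-- Extending the integral to the half-line gives the Gamma integral, with value exactly the right
side. -/
lemma integral_pow_mul_exp_neg_le {a : ℝ} (ha : 0 < a) (p : ℕ) :
    ∫ u in (0 : ℝ)..1, u ^ p * Real.exp (-(a * u)) ≤ p.factorial / a ^ (p + 1) := by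
  have h := Real.integral_rpow_mul_exp_neg_mul_Ioi (a := (p : ℝ) + 1) (by positivity) ha
  rw [Real.Gamma_nat_eq_factorial] at h
  have e : ∀ u : ℝ, u ^ ((p : ℝ) + 1 - 1) * Real.exp (-(a * u)) = u ^ p * Real.exp (-(a * u)) :=
    fun u => by rw [add_sub_cancel_right, Real.rpow_natCast]
  simp_rw [e] at h
  have hv : (1 / a) ^ ((p : ℝ) + 1) * p.factorial = p.factorial / a ^ (p + 1) := by
    rw [← Nat.cast_add_one, Real.rpow_natCast, one_div, inv_pow]
    field_simp
  rw [hv] at h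
  have hi : IntegrableOn (fun u => u ^ p * Real.exp (-(a * u))) (Set.Ioi 0) :=
    Integrable.of_integral_ne_zero (by rw [h]; positivity)
  rw [← h, intervalIntegral.integral_of_le zero_le_one]
  refine setIntegral_mono_set hi ?_ (Set.Ioc_subset_Ioi_self).eventuallyLE
  filter_upwards [ae_restrict_mem measurableSet_Ioi] with u hu
  have : 0 < u := hu
  positivity

lemma integral_pow_mul_gaussCorr_le {n : ℕ} {g : (𝔼 n) → ℝ} (hg : Continuous g)
    (hL : MemLp g 2 (stdGaussMeasure n)) (p : ℕ) :
    ∫ r in (0 : ℝ)..1, (1 - r) ^ p / p.factorial * gaussCorr g r ≤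
      Real.exp 1 * (lpNorm g 2 (stdGaussMeasure n) ^ 2 / (1 + Real.log
        (lpNorm g 2 (stdGaussMeasure n) / lpNorm g 1 (stdGaussMeasure n))) ^ (p + 1)) := by
  have hL1 : MemLp g 1 (stdGaussMeasure n) := hL.mono_exponent one_le_two
  -- If the `L¹` norm is 0 then `g = 0` almost everywhere and the left side is 0. On the right, `x /
  -- 0 = 0` and `log 0 = 0` make the denominator 1.
  rcases (lpNorm_nonneg (f := g) (p := 1) (μ := stdGaussMeasure n)).eq_or_lt with hA | hA
  · have hg0 := (lpNorm_eq_zero hL1 one_ne_zero).1 hA.symm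
    have h0 : ∫ x, g x ^ 2 ∂stdGaussMeasure n = 0 :=
      integral_eq_zero_of_ae (hg0.mono fun x hx => by simp [hx])
    have h1 : ∀ r, gaussCorr g r = 0 := fun r => by
      have := abs_gaussCov_le hL (Real.arccos r)
      rw [h0, mul_zero] at this
      exact abs_nonpos_iff.1 this
    simp only [h1, mul_zero, intervalIntegral.integral_zero]
    rw [← hA, div_zero, Real.log_zero]
    positivity
  have hAS := lpNorm_one_le_lpNorm_two hL
  have hexp := fun (r : ℝ) (hr : r ∈ Set.Ioo (0 : ℝ) 1) => gaussCorr_le_exp hg hL hA hr.1 hr.2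
  set A := lpNorm g 1 (stdGaussMeasure n)
  set S := lpNorm g 2 (stdGaussMeasure n)
  have hS : 0 < S := hA.trans_le hAS
  set l := Real.log (S / A) with hl
  have hl0 : 0 ≤ l := Real.log_nonneg ((one_le_div hA).2 hAS)
  have hc := continuous_gaussCorr hg hL
  have hfac : (0 : ℝ) < p.factorial := by exact_mod_cast p.factorial_pos
  calc ∫ r in (0 : ℝ)..1, (1 - r) ^ p / p.factorial * gaussCorr g r
      ≤ ∫ r in (0 : ℝ)..1, Real.exp 1 * S ^ 2 / p.factorial *
          ((1 - r) ^ p * Real.exp (-((1 + l) * (1 - r)))) := by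
        refine intervalIntegral.integral_mono_on_of_le_Ioo zero_le_one
          (Continuous.intervalIntegrable (by fun_prop) _ _)
          (Continuous.intervalIntegrable (by fun_prop) _ _) fun r hr => ?_
        have h1 : 0 < 1 - r := by linarith [hr.2]
        -- Replacing `l` by `1 + l` in the exponent costs a factor `exp(1-r) ≤ e`. This keeps the
        -- rate positive when `l = 0`, and it is the only source of the constant `e`.
        have h2 : Real.exp (-((1 - r) * l)) ≤ Real.exp 1 * Real.exp (-((1 + l) * (1 - r))) := by
          rw [← Real.exp_add]
          exact Real.exp_le_exp.2 (by linarith [hr.1])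
        have h3 := (hexp r hr).trans (mul_le_mul_of_nonneg_left h2 (sq_nonneg S))
        refine (mul_le_mul_of_nonneg_left h3 (by positivity)).trans (le_of_eq ?_)
        ring
    _ = Real.exp 1 * S ^ 2 / p.factorial *
          ∫ u in (0 : ℝ)..1, u ^ p * Real.exp (-((1 + l) * u)) := by
        rw [intervalIntegral.integral_const_mul, intervalIntegral.integral_comp_sub_left
          (fun u => u ^ p * Real.exp (-((1 + l) * u)))]
        simp
    _ ≤ Real.exp 1 * S ^ 2 / p.factorial * (p.factorial / (1 + l) ^ (p + 1)) :=
        mul_le_mul_of_nonneg_left (integral_pow_mul_exp_neg_le (by linarith) p) (by positivity)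
    _ = _ := by field_simp

end CorrelationBound

/-! ### Taylor's formula with integral remainder. -/

section Taylor

/-- Repeated integration by parts. The relation `G k' = G (k+1)` is assumed in integrated form on
`[0, 1]`; continuity of `G (k+1)` recovers the derivative in the interior. -/
lemma eq_sum_add_integral_of_integral_eq_sub {G : ℕ → ℝ → ℝ} {p : ℕ} (hc : ∀ k ≤ p + 1, Continuous (G k))
    (hG : ∀ k ≤ p, ∀ b, 0 ≤ b → b ≤ 1 → ∫ r in (0 : ℝ)..b, G (k + 1) r = G k b - G k 0) (m : ℕ)
    (hm : m ≤ p) :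
    G 0 1 = ∑ k ∈ Finset.range (m + 1), 1 / (k.factorial : ℝ) * G k 0 +
      ∫ r in (0 : ℝ)..1, (1 - r) ^ m / m.factorial * G (m + 1) r := by
  induction m with
  | zero =>
    have := hG 0 hm 1 zero_le_one le_rfl
    simp only [zero_add] at this
    simp [this]
  | succ m ih =>
    rw [ih (by omega), Finset.sum_range_succ _ (m + 1), add_assoc]
    congr 1
    have hf : ((m + 1).factorial : ℝ) = ((m : ℝ) + 1) * m.factorial := by
      rw [Nat.factorial_succ]; push_cast; ring
    have hm0 : (m.factorial : ℝ) ≠ 0 := by exact_mod_cast m.factorial_ne_zero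
    have hm1 : (m : ℝ) + 1 ≠ 0 := by positivity
    -- This primitive vanishes at `r = 1`, so the only boundary term is the Taylor term at 0.
    have hu : ∀ r : ℝ, HasDerivAt (fun r : ℝ => -((1 - r) ^ (m + 1) / ((m + 1).factorial : ℝ)))
        ((1 - r) ^ m / m.factorial) r := by
      intro r
      refine (((((hasDerivAt_id r).const_sub 1).pow (m + 1)).div_const _).neg).congr_deriv ?_
      rw [hf]
      simp only [id, add_tsub_cancel_right]
      push_cast
      field_simp
    have hv : ∀ r ∈ Set.Ioo (0 : ℝ) 1, HasDerivAt (G (m + 1)) (G (m + 2) r) r := by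
      intro r hr
      have hcm := hc (m + 2) (by omega)
      have h1 : HasDerivAt (fun b => (∫ r in (0 : ℝ)..b, G (m + 2) r) + G (m + 1) 0)
          (G (m + 2) r) r :=
        (intervalIntegral.integral_hasDerivAt_right (hcm.intervalIntegrable _ _)
          hcm.stronglyMeasurable.stronglyMeasurableAtFilter hcm.continuousAt).add_const _
      refine h1.congr_of_eventuallyEq ?_
      filter_upwards [Ioo_mem_nhds hr.1 hr.2] with b hb
      rw [hG (m + 1) hm b hb.1.le hb.2.le]
      ring
    have hc1 := hc (m + 1) (by omega)
    have hc2 := hc (m + 2) (by omega)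
    have := intervalIntegral.integral_mul_deriv_eq_deriv_mul_of_hasDerivAt (a := 0) (b := 1)
      (u := fun r : ℝ => -((1 - r) ^ (m + 1) / ((m + 1).factorial : ℝ))) (v := G (m + 1))
      (u' := fun r => (1 - r) ^ m / m.factorial) (v' := G (m + 2))
      (by fun_prop) (by fun_prop) (fun r _ => hu r) (by simpa using hv)
      (Continuous.intervalIntegrable (by fun_prop) _ _) (hc2.intervalIntegrable _ _)
    simp only [neg_mul, intervalIntegral.integral_neg, sub_self, sub_zero, one_pow] at this
    rw [zero_pow (by omega)] at this
    simp only [zero_div, neg_zero, zero_mul] at this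
    linarith

end Taylor

/-! ### Partial derivatives as iterated derivatives along basis vectors. -/

section PartialDeriv

variable {n : ℕ} {f : (𝔼 n) → ℝ}

lemma continuous_partialDeriv {N : ℕ} (hf : ContDiff ℝ (N : WithTop ℕ∞) f) {k : ℕ} (hk : k ≤ N)
    (i : Fin k → Fin n) : Continuous (partialDeriv i f) :=
  (ContinuousMultilinearMap.apply ℝ (fun _ : Fin k => 𝔼 n) ℝ
    fun j => EuclideanSpace.single (i j) (1 : ℝ)).continuous.comp
    (hf.continuous_iteratedFDeriv (by exact_mod_cast hk))

lemma contDiff_partialDeriv {N : ℕ} (hf : ContDiff ℝ (N : WithTop ℕ∞) f) {k : ℕ} (hk : k < N)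
    (i : Fin k → Fin n) : ContDiff ℝ 1 (partialDeriv i f) :=
  (ContinuousMultilinearMap.apply ℝ (fun _ : Fin k => 𝔼 n) ℝ
    fun j => EuclideanSpace.single (i j) (1 : ℝ)).contDiff.comp
    (hf.iteratedFDeriv_right (by rw [add_comm]; exact_mod_cast hk))

/-- The outermost derivative of `iteratedFDeriv` acts on the first argument, so the new index goes
in front. -/
lemma partialDeriv_cons {N : ℕ} (hf : ContDiff ℝ (N : WithTop ℕ∞) f) {k : ℕ} (hk : k < N)
    (a : Fin n) (i : Fin k → Fin n) :
    partialDeriv (Fin.cons a i : Fin (k + 1) → Fin n) f =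
      fun x => fderiv ℝ (partialDeriv i f) x (EuclideanSpace.single a 1) := by
  ext x
  have hd : DifferentiableAt ℝ (iteratedFDeriv ℝ k f) x :=
    hf.differentiable_iteratedFDeriv (by exact_mod_cast hk) x
  have h : HasFDerivAt (partialDeriv i f) _ x :=
    (ContinuousMultilinearMap.apply ℝ (fun _ : Fin k => 𝔼 n) ℝ
      fun j => EuclideanSpace.single (i j) (1 : ℝ)).hasFDerivAt.comp x hd.hasFDerivAt
  rw [h.fderiv, partialDeriv, iteratedFDeriv_succ_apply_left]
  rfl

lemma partialDeriv_zero (i : Fin 0 → Fin n) : partialDeriv i f = f := by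
  ext x
  simp [partialDeriv]

/-- At correlation 0 the two vectors are independent, so each summand is the square of a mean, which
is a coordinate of the integrated tensor. -/
lemma norm_integral_nablaPow_sq {k : ℕ}
    (hL : ∀ i : Fin k → Fin n, MemLp (partialDeriv i f) 2 (stdGaussMeasure n)) :
    ‖∫ x, nablaPow k f x ∂stdGaussMeasure n‖ ^ 2 =
      ∑ i : Fin k → Fin n, gaussCorr (partialDeriv i f) 0 := by
  rw [EuclideanSpace.real_norm_sq_eq]
  refine Finset.sum_congr rfl fun i _ => ?_
  rw [gaussCorr_zero, eval_integral_piLp]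
  · rfl
  · exact fun i => (hL i).integrable one_le_two

end PartialDeriv

end

/-! ### Assembly of the variance bound. -/

theorem mainTheorem5 :
    ∃ C : ℝ, 0 < C ∧
      ∀ (n p : ℕ), 1 ≤ p →
      ∀ f : EuclideanSpace ℝ (Fin n) → ℝ,
        ContDiff ℝ ((p + 1 : ℕ) : WithTop ℕ∞) f →
        (∀ k : ℕ, k ≤ p + 1 → ∀ i : Fin k → Fin n,
          MemLp (partialDeriv i f) 2 (stdGaussMeasure n)) →
        variance f (stdGaussMeasure n) ≤
          (∑ k ∈ Finset.Icc 1 p,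
            (1 / (k.factorial : ℝ)) * ‖∫ x, nablaPow k f x ∂(stdGaussMeasure n)‖ ^ 2) +
          C * ∑ i : Fin (p + 1) → Fin n,
            lpNorm (partialDeriv i f) 2 (stdGaussMeasure n) ^ 2 /
              (1 + Real.log (lpNorm (partialDeriv i f) 2 (stdGaussMeasure n) /
                lpNorm (partialDeriv i f) 1 (stdGaussMeasure n))) ^ (p + 1) := by
  refine ⟨Real.exp 1, Real.exp_pos 1, fun n p _ f hf hL => ?_⟩
  let G : ℕ → ℝ → ℝ := fun k r => ∑ i : Fin k → Fin n, gaussCorr (partialDeriv i f) r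
  have hcorr : ∀ k ≤ p + 1, ∀ i : Fin k → Fin n, Continuous (gaussCorr (partialDeriv i f)) :=
    fun k hk i => continuous_gaussCorr (continuous_partialDeriv hf hk i) (hL k hk i)
  have hc : ∀ k ≤ p + 1, Continuous (G k) := fun k hk =>
    continuous_finsetSum _ fun i _ => hcorr k hk i
  have hG : ∀ k ≤ p, ∀ b, 0 ≤ b → b ≤ 1 →
      ∫ r in (0 : ℝ)..b, G (k + 1) r = G k b - G k 0 := by
    intro k hk b hb0 hb1
    have hk' : k < p + 1 := by omega
    -- A multi-index of length `k + 1` is a first index `a` followed by one of length `k`, so `G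
    -- (k+1)` sums the correlations of the gradients of the order-`k` derivatives.
    have hs : ∀ r, G (k + 1) r = ∑ i : Fin k → Fin n, ∑ a, gaussCorr
        (fun x => fderiv ℝ (partialDeriv i f) x (EuclideanSpace.single a 1)) r := by
      intro r
      simp only [G]
      rw [← (Fin.consEquiv fun _ : Fin (k + 1) => Fin n).sum_comp, Fintype.sum_prod_type_right]
      refine Finset.sum_congr rfl fun i _ => Finset.sum_congr rfl fun a _ => ?_
      exact congrArg (fun g => gaussCorr g r) (partialDeriv_cons hf hk' a i)
    simp_rw [hs]
    rw [intervalIntegral.integral_finsetSum]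
    · simp only [G, ← Finset.sum_sub_distrib]
      refine Finset.sum_congr rfl fun i _ => ?_
      refine integral_sum_gaussCorr_fderiv (contDiff_partialDeriv hf hk' i) (hL k (by omega) i)
        (fun a => ?_) hb0 hb1
      rw [← partialDeriv_cons hf hk']
      exact hL _ (by omega) _
    · intro i _
      refine (continuous_finsetSum _ fun a _ => ?_).intervalIntegrable _ _
      rw [← partialDeriv_cons hf hk']
      exact hcorr _ (by omega) _
  have hfL : MemLp f 2 (stdGaussMeasure n) := by
    simpa [partialDeriv_zero] using hL 0 (by omega) Fin.elim0
  have hG0 : ∀ r, G 0 r = gaussCorr f r := fun r => by simp [G, partialDeriv_zero]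
  have hT := eq_sum_add_integral_of_integral_eq_sub hc hG p le_rfl
  have hvar : variance f (stdGaussMeasure n) = G 0 1 - G 0 0 := by
    rw [variance_eq_sub hfL, hG0, hG0, gaussCorr_one hfL, gaussCorr_zero]
    rfl
  have hsum : ∑ k ∈ Finset.range (p + 1), 1 / (k.factorial : ℝ) * G k 0 = G 0 0 +
      ∑ k ∈ Finset.Icc 1 p,
        (1 / (k.factorial : ℝ)) * ‖∫ x, nablaPow k f x ∂(stdGaussMeasure n)‖ ^ 2 := by
    rw [Finset.range_eq_Ico, Finset.sum_eq_sum_Ico_succ_bot (by omega)]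
    simp only [Nat.factorial_zero, Nat.cast_one, div_one, one_mul]
    congr 1
    refine Finset.sum_congr rfl fun k hk => ?_
    rw [norm_integral_nablaPow_sq fun i => hL k (by simp at hk; omega) i]
  -- The Taylor term of order 0 is `(E f)²` and cancels against the variance; only the remainder is
  -- left to estimate, one multi-index at a time.
  rw [hvar, hT, hsum, add_assoc, add_sub_cancel_left]
  gcongr
  simp only [G, Finset.mul_sum]
  rw [intervalIntegral.integral_finsetSum]
  · exact Finset.sum_le_sum fun i _ => integral_pow_mul_gaussCorr_le
      (continuous_partialDeriv hf le_rfl i) (hL _ le_rfl i) p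
  · intro i _
    have := hcorr _ le_rfl i
    exact Continuous.intervalIntegrable (by fun_prop) _ _
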